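/- Let $\phi:\mathbb{R}\to[0,\infty)$ be one of the following kernels on $\mathbb{R}$, each of integral one: the Poisson kernel $\varphi_1(x)=\frac1\pi\frac1{x^2+1}$; the heat kernel $\varphi_2(x)=\frac1{\sqrt{4\pi}}e^{-x^2/4}$; or, for some $0<\alpha<1$, the fractional Poisson kernel $\varphi_3^\alpha(x)=C^\alpha (x^2+1)^{-(2-\alpha)/2}$, where $C^\alpha>0$ is such that $\|\varphi_3^\alpha\|_1=1$. For $t>0$ put $\phi_t(x)=\frac1t\phi\left(\frac xt\right)$, and for $u\in W^{1,1}(\mathbb{R})$ (real-valued) let $$u^*(x)=\sup_{t>0}\,(|u|*\phi_t)(x),\qquad x\in\mathbb{R}.$$ Let $u_j,u\in W^{1,1}(\mathbb{R})$, $j\in\mathbb{N}$, be such that $\|u_j-u\|_{1}+\|u_j'-u'\|_{1}\to0$ as $j\to\infty$. Then $u^*$ and all $u_j^*$ are weakly differentiable with weak derivatives in $L^1(\mathbb{R})$, and $$\|(u_j^*)'\|_1\to\|(u^*)'\|_1\qquad\text{as } j\to\infty.$$ -/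

import Mathlib

open Filter Topology MeasureTheory
open scoped ContDiff

noncomputable section

namespace ConvMax

/-- `g` is the weak derivative of `f` on `ℝ`: both are locally integrable and
`∫ f ψ' = - ∫ g ψ` for every smooth compactly supported test function `ψ`. -/
def IsWeakDeriv (f g : ℝ → ℝ) : Prop :=
  LocallyIntegrable f volume ∧ LocallyIntegrable g volume ∧
    ∀ ψ : ℝ → ℝ, ContDiff ℝ ∞ ψ → HasCompactSupport ψ →
      ∫ x, f x * deriv ψ x = - ∫ x, g x * ψ x

/-- `f` has a weak derivative (in `L¹_loc`). -/
def WeaklyDifferentiable (f : ℝ → ℝ) : Prop := ∃ g : ℝ → ℝ, IsWeakDeriv f g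

open Classical in
/-- The weak derivative of `f`, which is unique up to null sets
(and `0` if `f` is not weakly differentiable). -/
def weakDeriv (f : ℝ → ℝ) : ℝ → ℝ :=
  if h : WeaklyDifferentiable f then h.choose else fun _ => 0

/-- The Sobolev space `W^{1,1}(ℝ)`: integrable functions whose weak derivative exists and is
integrable. -/
def MemW11 (f : ℝ → ℝ) : Prop :=
  Integrable f volume ∧ WeaklyDifferentiable f ∧ Integrable (weakDeriv f) volume

/-- The `L¹(ℝ)` norm. -/
def normL1 (f : ℝ → ℝ) : ℝ := ∫ x, |f x|

/-- The norm `‖f‖₁ + ‖f'‖₁` of `W^{1,1}(ℝ)`. -/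
def normW11 (f : ℝ → ℝ) : ℝ := normL1 f + normL1 (weakDeriv f)

/-- The Poisson kernel on `ℝ`. -/
def realPoissonKernel (x : ℝ) : ℝ := 1 / Real.pi * (1 / (x ^ 2 + 1))

/-- The heat kernel on `ℝ` (at time one). -/
def heatKernel (x : ℝ) : ℝ := 1 / Real.sqrt (4 * Real.pi) * Real.exp (-x ^ 2 / 4)

/-- The unnormalized profile `(x² + 1)^{-(2-α)/2}`. -/
def fracProfile (α x : ℝ) : ℝ := 1 / (x ^ 2 + 1) ^ ((2 - α) / 2)

/-- The fractional Poisson kernel on `ℝ`, normalized to have integral one. -/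
def fracPoissonKernel (α x : ℝ) : ℝ := (∫ y, fracProfile α y)⁻¹ * fracProfile α x

/-- `φ` is the Poisson kernel, the heat kernel, or one of the fractional Poisson kernels with
parameter `0 < α < 1`. -/
def IsKernel (φ : ℝ → ℝ) : Prop :=
  φ = realPoissonKernel ∨ φ = heatKernel ∨
    ∃ α : ℝ, 0 < α ∧ α < 1 ∧ φ = fracPoissonKernel α

/-- The dilation `φ_t(x) = t⁻¹ φ(x / t)`. -/
def dilate (φ : ℝ → ℝ) (t x : ℝ) : ℝ := 1 / t * φ (x / t)

/-- The extension `(|u| * φ_t)(x)`. -/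
def extension (φ u : ℝ → ℝ) (x t : ℝ) : ℝ :=
  convolution (fun y => |u y|) (dilate φ t) (ContinuousLinearMap.mul ℝ ℝ) volume x

/-- The maximal function `u*(x) = sup_{t > 0} (|u| * φ_t)(x)`. For `u ∈ W^{1,1}(ℝ)`, which is
essentially bounded, and `φ ≥ 0` of integral one, the supremum is over a bounded set. -/
def maximalFunction (φ u : ℝ → ℝ) (x : ℝ) : ℝ :=
  ⨆ t : Set.Ioi (0 : ℝ), extension φ u x t

end ConvMax

end

/-! Take an absolutely continuous representative of `u`, and put `f = |u|`, `F = u*`. The kernel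
enters only through the fact that `F` is convex on every interval where `F > f`. Indeed the
extension `U(x,t) = (f * φ_t)(x)` solves `a U_tt + (b/t) U_t + U_xx = 0` with `a ≥ 0`, where `(a,b)`
is `(1,0)` for the Poisson, `(0,-1/2)` for the heat and `(1,α)` for the fractional Poisson kernel.
If `F(x) > f(x)`, the supremum is attained at some `t > 0`; there `U_t = 0` and `U_tt ≤ 0`, hence
`U_xx ≥ 0`. So `F` is touched from below at `x` by a function with nonnegative second derivative,
and `convexOn_of_touching` gives convexity. The remaining properties needed, collected in
`Detached`, are soft.

For such a pair, `f` controls the variation of `F` on every sublevel set of the gap: `∫_{F-f≤δ} |F'|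
≤ ∫_{F-f≤δ} |f'|`. To see this, test `sign F'`, which is locally nondecreasing off the contact set,
against the nonnegative compactly supported function `max(f, F-ε) - max(f, F-δ)`, whose derivative
is `F' - f'` on `{ε < F-f ≤ δ}` and zero elsewhere; then let `ε → 0`. For large `δ` this gives `F' ∈
L¹`, and `F` is absolutely continuous as a limit of its truncations `max(f, F-ε)`.

Convergence: since `‖w‖_∞ ≤ ‖w'‖₁` on `W^{1,1}`, both `f_j → f` and `F_j → F` uniformly. Lower
semicontinuity of the variation gives one inequality. For the other, where `F - f` is bounded below,
the `F_j` are eventually convex on intervals of a fixed length, so their derivatives converge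
boundedly. Where `F_j - f_j ≤ δ`, the variation of `F_j` is at most `∫ |f_j'|`, which for small `δ`
is close to the integral of `|f'|` over the contact set `{F = f}`, and there `f' = F'` almost
everywhere. So no variation is created in the limit. -/

namespace ConvMax

/-! ### Absolutely continuous functions with integrable derivative -/

/-- `f` is an absolutely continuous primitive on `ℝ` of the integrable function `g`. -/
structure HasPrim (f g : ℝ → ℝ) : Prop where
  integrable : Integrable g volume
  sub_eq : ∀ x y, f y - f x = ∫ t in x..y, g t

namespace HasPrim

variable {f g f₁ g₁ f₂ g₂ : ℝ → ℝ}

lemma intervalIntegrable (h : HasPrim f g) (x y : ℝ) : IntervalIntegrable g volume x y :=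
  h.integrable.intervalIntegrable

lemma eq_add (h : HasPrim f g) (a : ℝ) : f = fun x => f a + ∫ t in a..x, g t := by
  funext x
  rw [← h.sub_eq a x]; ring

lemma ae_hasDerivAt (h : HasPrim f g) : ∀ᵐ x, HasDerivAt f (g x) x := by
  filter_upwards [_root_.LocallyIntegrable.ae_hasDerivAt_integral
    h.integrable.locallyIntegrable] with x hx
  rw [h.eq_add 0]
  exact (hx 0).const_add _

lemma deriv_ae_eq (h : HasPrim f g) : deriv f =ᵐ[volume] g := by
  filter_upwards [h.ae_hasDerivAt] with x hx using hx.deriv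

lemma integrable_deriv (h : HasPrim f g) : Integrable (deriv f) volume :=
  h.integrable.congr h.deriv_ae_eq.symm

lemma hasPrim_deriv (h : HasPrim f g) : HasPrim f (deriv f) where
  integrable := h.integrable_deriv
  sub_eq x y := by
    rw [h.sub_eq]
    exact intervalIntegral.integral_congr_ae (h.deriv_ae_eq.mono fun x hx _ => hx.symm)

lemma absolutelyContinuousOnInterval (h : HasPrim f g) (a b : ℝ) :
    AbsolutelyContinuousOnInterval f a b := by
  have h1 := (h.intervalIntegrable a b).absolutelyContinuousOnInterval_intervalIntegral
    (c := a) (by simp)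
  have h2 : AbsolutelyContinuousOnInterval (fun _ : ℝ => f a) a b :=
    (LipschitzWith.const (f a)).lipschitzOnWith.absolutelyContinuousOnInterval
  rw [h.eq_add a]
  exact h2.add h1

lemma of_absolutelyContinuousOnInterval (h : ∀ a b, AbsolutelyContinuousOnInterval f a b)
    (hi : Integrable (deriv f) volume) : HasPrim f (deriv f) where
  integrable := hi
  sub_eq x y := (h x y).integral_deriv_eq_sub.symm

lemma sub (h₁ : HasPrim f₁ g₁) (h₂ : HasPrim f₂ g₂) :
    HasPrim (fun x => f₁ x - f₂ x) (fun x => g₁ x - g₂ x) where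
  integrable := h₁.integrable.sub h₂.integrable
  sub_eq x y := by
    rw [intervalIntegral.integral_sub (h₁.intervalIntegrable _ _) (h₂.intervalIntegrable _ _),
      ← h₁.sub_eq, ← h₂.sub_eq]
    ring

lemma continuous (h : HasPrim f g) : Continuous f := by
  rw [h.eq_add 0]
  exact continuous_const.add
    (intervalIntegral.continuous_primitive (fun a b => h.intervalIntegrable a b) 0)

lemma abs_sub_le (h : HasPrim f g) {x y : ℝ} (hxy : x ≤ y) :
    |f y - f x| ≤ ∫ t in x..y, |g t| := by
  rw [h.sub_eq]
  exact intervalIntegral.abs_integral_le_integral_abs hxy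

lemma abs_sub_le_integral (h : HasPrim f g) (x y : ℝ) : |f y - f x| ≤ ∫ t, |g t| := by
  wlog hxy : x ≤ y generalizing x y
  · rw [abs_sub_comm]; exact this y x (le_of_not_ge hxy)
  refine (h.abs_sub_le hxy).trans ?_
  rw [intervalIntegral.integral_of_le hxy]
  exact setIntegral_le_integral h.integrable.abs (ae_of_all _ fun x => abs_nonneg _)

/-- A primitive of an integrable function has a limit at `-∞`. -/
lemma exists_tendsto_atBot (h : HasPrim f g) : ∃ c, Tendsto f atBot (𝓝 c) := by
  refine ⟨f 0 - ∫ t in Set.Iic 0, g t, ?_⟩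
  have h1 := intervalIntegral_tendsto_integral_Iic (f := g) (μ := volume) 0 h.integrable.integrableOn
    (tendsto_id (x := (atBot : Filter ℝ)))
  refine (h1.const_sub (f 0)).congr fun x => ?_
  simp only [id]
  rw [← h.sub_eq x 0]; ring

lemma exists_tendsto_atTop (h : HasPrim f g) : ∃ c, Tendsto f atTop (𝓝 c) := by
  refine ⟨f 0 + ∫ t in Set.Ioi 0, g t, ?_⟩
  have h1 := intervalIntegral_tendsto_integral_Ioi (f := g) (μ := volume) 0 h.integrable.integrableOn
    (tendsto_id (x := (atTop : Filter ℝ)))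
  refine (h1.const_add (f 0)).congr fun x => ?_
  simp only [id]
  rw [← h.sub_eq 0 x]; ring

/-- The limit exists because the derivative is integrable; a nonzero limit would make `|f|` bounded
below on a half-line, against integrability. -/
lemma tendsto_atBot_zero (h : HasPrim f g) (hf : Integrable f volume) :
    Tendsto f atBot (𝓝 0) := by
  obtain ⟨c, hc⟩ := h.exists_tendsto_atBot
  have h0 : c = 0 := by
    by_contra hne
    obtain ⟨a, ha⟩ := eventually_atBot.1 ((hc.norm).eventually
      (lt_mem_nhds (show ‖c‖ / 2 < ‖c‖ by have := norm_pos_iff.2 hne; linarith)))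
    have h1 : IntegrableOn (fun _ : ℝ => ‖c‖ / 2) (Set.Iic a) volume := by
      refine hf.norm.integrableOn.mono' aestronglyMeasurable_const ?_
      filter_upwards [ae_restrict_mem measurableSet_Iic] with x hx
      have := ha x hx
      rw [Real.norm_of_nonneg (by positivity)]
      exact this.le
    rw [integrableOn_const_iff] at h1
    simp [hne] at h1
  rwa [h0] at hc

lemma tendsto_atTop_zero (h : HasPrim f g) (hf : Integrable f volume) :
    Tendsto f atTop (𝓝 0) := by
  obtain ⟨c, hc⟩ := h.exists_tendsto_atTop
  have h0 : c = 0 := by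
    by_contra hne
    obtain ⟨a, ha⟩ := eventually_atTop.1 ((hc.norm).eventually
      (lt_mem_nhds (show ‖c‖ / 2 < ‖c‖ by have := norm_pos_iff.2 hne; linarith)))
    have h1 : IntegrableOn (fun _ : ℝ => ‖c‖ / 2) (Set.Ici a) volume := by
      refine hf.norm.integrableOn.mono' aestronglyMeasurable_const ?_
      filter_upwards [ae_restrict_mem measurableSet_Ici] with x hx
      have := ha x hx
      rw [Real.norm_of_nonneg (by positivity)]
      exact this.le
    rw [integrableOn_const_iff] at h1
    simp [hne] at h1
  rwa [h0] at hc

/-- Integrate from `-∞`, where `f` vanishes. This embedding of `W^{1,1}` into bounded functions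
turns Sobolev convergence into uniform convergence. -/
lemma abs_le_integral (h : HasPrim f g) (hf : Integrable f volume) (x : ℝ) :
    |f x| ≤ ∫ t, |g t| := by
  have h1 : Tendsto (fun y => |f x - f y|) atBot (𝓝 |f x - 0|) :=
    ((h.tendsto_atBot_zero hf).const_sub _).abs
  rw [sub_zero] at h1
  exact le_of_tendsto' h1 fun y => h.abs_sub_le_integral y x

lemma of_tendsto {f : ℝ → ℝ} {g : ℝ → ℝ} {F G : ℕ → ℝ → ℝ} {b : ℝ → ℝ}
    (h : ∀ n, HasPrim (F n) (G n)) (hf : ∀ x, Tendsto (fun n => F n x) atTop (𝓝 (f x)))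
    (hg : ∀ᵐ x, Tendsto (fun n => G n x) atTop (𝓝 (g x))) (hb : Integrable b volume)
    (hG : ∀ n, ∀ᵐ x, |G n x| ≤ b x) : HasPrim f g where
  integrable := by
    refine hb.mono' (aestronglyMeasurable_of_tendsto_ae atTop
      (fun n => (h n).integrable.aestronglyMeasurable) hg) ?_
    filter_upwards [hg, ae_all_iff.2 hG] with x hx hx'
    exact le_of_tendsto' hx.norm fun n => hx' n
  sub_eq x y := by
    refine tendsto_nhds_unique ((hf y).sub (hf x)) ?_
    simp only [(h _).sub_eq]
    refine intervalIntegral.tendsto_integral_filter_of_dominated_convergence b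
      (Eventually.of_forall fun n => (h n).integrable.aestronglyMeasurable.restrict)
      (Eventually.of_forall fun n => (hG n).mono fun x hx _ => hx)
      hb.intervalIntegrable (hg.mono fun x hx _ => hx)

end HasPrim
-- Detached pairs and the truncations `max(f, F - ε)`
lemma lipschitzOnWith_ball_of_convexOn_Icc {F : ℝ → ℝ} {x r B : ℝ} (hr : 0 < r)
    (hF : ConvexOn ℝ (Set.Icc (x - r) (x + r)) F) (hB : ∀ y, |F y| ≤ B) :
    LipschitzOnWith (4 * B / r).toNNReal F (Metric.ball x (r / 2)) := by
  have h1 : ConvexOn ℝ (Metric.ball x r) F := by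
    refine hF.subset ?_ (convex_ball x r)
    rw [Real.ball_eq_Ioo]
    exact Set.Ioo_subset_Icc_self
  have h2 := h1.lipschitzOnWith_of_abs_le (half_pos hr) (fun a _ => hB a)
  rwa [sub_half, show 2 * B / (r / 2) = 4 * B / r by field_simp; ring] at h2

/-- The continuous bounded function `F` lies above the absolutely continuous function `f`, is convex
on every interval where it lies strictly above, and `F - f` vanishes at infinity. -/
structure Detached (f F : ℝ → ℝ) : Prop where
  hasPrim : HasPrim f (deriv f)
  continuous : Continuous F
  le : ∀ x, f x ≤ F x
  isCompact : ∀ ε, 0 < ε → IsCompact {x | ε ≤ F x - f x}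
  bounded : ∃ B, ∀ x, |F x| ≤ B
  convexOn : ∀ a b, (∀ x ∈ Set.Icc a b, f x < F x) → ConvexOn ℝ (Set.Icc a b) F

namespace Detached

variable {f F : ℝ → ℝ}

lemma continuous_sub (h : Detached f F) : Continuous fun x => F x - f x :=
  h.continuous.sub h.hasPrim.continuous

/-- The compact set `{F - f ≥ ε}` has positive distance to the complement of the open set `{F - f >
ε/2}`. The uniform radius yields uniform Lipschitz constants for the convex pieces of `F`. -/
lemma exists_radius (h : Detached f F) {ε : ℝ} (hε : 0 < ε) :
    ∃ r, 0 < r ∧ ∀ x, ε ≤ F x - f x → ∀ y ∈ Set.Icc (x - r) (x + r), ε / 2 < F y - f y := by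
  have hU : IsOpen {x | ε / 2 < F x - f x} := isOpen_lt continuous_const h.continuous_sub
  obtain ⟨r, hr, hsub⟩ := (h.isCompact ε hε).exists_cthickening_subset_open hU
    (fun x (hx : ε ≤ F x - f x) => show ε / 2 < F x - f x by linarith)
  refine ⟨r, hr, fun x hx y hy => hsub (Metric.mem_cthickening_of_dist_le y x r _ hx ?_)⟩
  rw [Real.dist_eq, abs_le]
  constructor <;> linarith [hy.1, hy.2]

lemma exists_radius_convexOn (h : Detached f F) {ε : ℝ} (hε : 0 < ε) :
    ∃ r, 0 < r ∧ ∀ x, ε ≤ F x - f x → ConvexOn ℝ (Set.Icc (x - r) (x + r)) F := by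
  obtain ⟨r, hr, H⟩ := h.exists_radius hε
  exact ⟨r, hr, fun x hx => h.convexOn _ _ fun y hy => by linarith [H x hx y hy]⟩

lemma exists_lipschitzOnWith (h : Detached f F) {ε : ℝ} (hε : 0 < ε) :
    ∃ r, 0 < r ∧ ∃ L : NNReal, ∀ x, ε ≤ F x - f x → LipschitzOnWith L F (Metric.ball x r) := by
  obtain ⟨r, hr, H⟩ := h.exists_radius_convexOn hε
  obtain ⟨B, hB⟩ := h.bounded
  exact ⟨r / 2, half_pos hr, _, fun x hx => lipschitzOnWith_ball_of_convexOn_Icc hr (H x hx) hB⟩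

/-- If either point has gap at least `ε`, then `F` is Lipschitz on a ball containing both; otherwise
both truncated values are values of `f`. The sum of the two moduli covers all cases and transfers
absolute continuity from `f`. -/
lemma exists_abs_sub_truncation_le (h : Detached f F) {ε : ℝ} (hε : 0 < ε) :
    ∃ r, 0 < r ∧ ∃ L : NNReal, ∀ x y, |x - y| < r →
      |max (f x) (F x - ε) - max (f y) (F y - ε)| ≤ |f x - f y| + L * |x - y| := by
  obtain ⟨r, hr, L, hL⟩ := h.exists_lipschitzOnWith hε
  refine ⟨r, hr, L, fun x y hxy => ?_⟩
  have key : |F x - F y| ≤ L * |x - y| →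
      |max (f x) (F x - ε) - max (f y) (F y - ε)| ≤ |f x - f y| + L * |x - y| := by
    intro hF
    refine (abs_max_sub_max_le_max _ _ _ _).trans (max_le ?_ ?_)
    · have : 0 ≤ L * |x - y| := by positivity
      linarith
    · rw [sub_sub_sub_cancel_right]
      linarith [abs_nonneg (f x - f y)]
  by_cases hx : ε ≤ F x - f x
  · refine key ?_
    have := (hL x hx).dist_le_mul x (Metric.mem_ball_self hr) y
      (by rwa [Metric.mem_ball, dist_comm, Real.dist_eq])
    simpa [Real.dist_eq] using this
  by_cases hy : ε ≤ F y - f y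
  · refine key ?_
    have := (hL y hy).dist_le_mul x (by rwa [Metric.mem_ball, Real.dist_eq]) y
      (Metric.mem_ball_self hr)
    simpa [Real.dist_eq] using this
  rw [max_eq_left (by linarith), max_eq_left (by linarith)]
  have : 0 ≤ L * |x - y| := by positivity
  linarith

lemma absolutelyContinuousOnInterval_truncation (h : Detached f F) {ε : ℝ} (hε : 0 < ε)
    (a b : ℝ) : AbsolutelyContinuousOnInterval (fun x => max (f x) (F x - ε)) a b := by
  obtain ⟨r, hr, L, hL⟩ := h.exists_abs_sub_truncation_le hε
  have hf := (absolutelyContinuousOnInterval_iff f a b).1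
    (h.hasPrim.absolutelyContinuousOnInterval a b)
  rw [absolutelyContinuousOnInterval_iff]
  intro e he
  obtain ⟨δ, hδ, H⟩ := hf (e / 2) (half_pos he)
  -- Total length below `r` makes each interval short enough for `hL`; the last entry keeps the
  -- Lipschitz part below `e / 2`, with `L + 1` because `L` may be zero.
  refine ⟨min δ (min r (e / (2 * (L + 1)))), by positivity, fun E hE hlt => ?_⟩
  have h1 := H E hE (hlt.trans_le (min_le_left _ _))
  have h2 := hlt.trans_le ((min_le_right _ _).trans (min_le_left _ _))
  have h3 := hlt.trans_le ((min_le_right _ _).trans (min_le_right _ _))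
  have h4 : ∀ i ∈ Finset.range E.1,
      dist (max (f (E.2 i).1) (F (E.2 i).1 - ε)) (max (f (E.2 i).2) (F (E.2 i).2 - ε)) ≤
        dist (f (E.2 i).1) (f (E.2 i).2) + L * dist (E.2 i).1 (E.2 i).2 := by
    intro i hi
    simp only [Real.dist_eq]
    refine hL _ _ (lt_of_le_of_lt ?_ h2)
    rw [← Real.dist_eq]
    exact Finset.single_le_sum (f := fun i => dist (E.2 i).1 (E.2 i).2)
      (fun i _ => dist_nonneg) hi
  refine (Finset.sum_le_sum h4).trans_lt ?_
  rw [Finset.sum_add_distrib, ← Finset.mul_sum]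
  have hL0 : (0 : ℝ) ≤ L := L.2
  rw [lt_div_iff₀ (by positivity)] at h3
  have h5 : 0 ≤ ∑ i ∈ Finset.range E.1, dist (E.2 i).1 (E.2 i).2 :=
    Finset.sum_nonneg fun i _ => dist_nonneg
  nlinarith

lemma truncation_eventuallyEq_of_lt (h : Detached f F) {ε x : ℝ} (hx : ε < F x - f x) :
    (fun x => max (f x) (F x - ε)) =ᶠ[𝓝 x] fun x => F x - ε := by
  filter_upwards [(isOpen_lt continuous_const h.continuous_sub).mem_nhds hx] with y hy
  have : ε < F y - f y := hy
  exact max_eq_right (by linarith)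

lemma deriv_truncation_of_lt (h : Detached f F) {ε x : ℝ} (hx : ε < F x - f x) :
    deriv (fun x => max (f x) (F x - ε)) x = deriv F x := by
  rw [(h.truncation_eventuallyEq_of_lt hx).deriv_eq, deriv_sub_const]

end Detached

lemma deriv_eq_of_le_of_eq {f g : ℝ → ℝ} {x : ℝ} (hf : DifferentiableAt ℝ f x)
    (hg : DifferentiableAt ℝ g x) (hle : ∀ y, f y ≤ g y) (hx : f x = g x) :
    deriv f x = deriv g x := by
  have h1 : IsLocalMin (fun y => g y - f y) x := by
    refine Eventually.of_forall fun y => ?_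
    simp only [hx, sub_self]
    linarith [hle y]
  have h2 := h1.deriv_eq_zero
  rw [deriv_fun_sub hg hf] at h2
  linarith

lemma ae_differentiableAt_of_absolutelyContinuousOnInterval {f : ℝ → ℝ}
    (h : ∀ a b, AbsolutelyContinuousOnInterval f a b) : ∀ᵐ x, DifferentiableAt ℝ f x := by
  have h1 : ∀ᵐ x, ∀ n : ℕ, x ∈ Set.uIcc (-(n : ℝ)) n → DifferentiableAt ℝ f x :=
    ae_all_iff.2 fun n => (h _ _).ae_differentiableAt
  filter_upwards [h1] with x hx
  obtain ⟨n, hn⟩ := exists_nat_ge |x|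
  refine hx n ?_
  rw [Set.uIcc_of_le (by linarith [abs_nonneg x])]
  exact abs_le.1 hn

namespace Detached

variable {f F : ℝ → ℝ}

/-- The truncation lies above `f` and equals it at such points, so wherever both are differentiable
the two derivatives agree. This includes the level set `F - f = ε`. -/
lemma ae_deriv_truncation_of_le (h : Detached f F) {ε : ℝ} (hε : 0 < ε) :
    ∀ᵐ x, F x - f x ≤ ε → deriv (fun x => max (f x) (F x - ε)) x = deriv f x := by
  filter_upwards [h.hasPrim.ae_hasDerivAt, ae_differentiableAt_of_absolutelyContinuousOnInterval
    (h.absolutelyContinuousOnInterval_truncation hε)] with x hf hG hx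
  exact (deriv_eq_of_le_of_eq hf.differentiableAt hG (fun y => le_max_left _ _)
    (max_eq_left (by linarith)).symm).symm

lemma exists_abs_deriv_le (h : Detached f F) {ε : ℝ} (hε : 0 < ε) :
    ∃ L : ℝ, 0 ≤ L ∧ ∀ x, ε ≤ F x - f x → |deriv F x| ≤ L := by
  obtain ⟨r, hr, L, hL⟩ := h.exists_lipschitzOnWith hε
  exact ⟨L, L.2, fun x hx => norm_deriv_le_of_lipschitzOn (Metric.ball_mem_nhds x hr) (hL x hx)⟩

lemma integrable_deriv_truncation (h : Detached f F) {ε : ℝ} (hε : 0 < ε) :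
    Integrable (deriv fun x => max (f x) (F x - ε)) volume := by
  obtain ⟨L, hL0, hL⟩ := h.exists_abs_deriv_le hε
  have hK := h.isCompact ε hε
  have hb : Integrable (fun x => |deriv f x| +
      Set.indicator {x | ε ≤ F x - f x} (fun _ => L) x) volume := by
    refine h.hasPrim.integrable.abs.add ?_
    rw [integrable_indicator_iff hK.measurableSet]
    exact integrableOn_const hK.measure_ne_top
  refine hb.mono' (measurable_deriv _).aestronglyMeasurable ?_
  filter_upwards [h.ae_deriv_truncation_of_le hε] with x hx
  rw [Real.norm_eq_abs]
  by_cases hxε : F x - f x ≤ ε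
  · rw [hx hxε]
    have : 0 ≤ Set.indicator {x | ε ≤ F x - f x} (fun _ => L) x :=
      Set.indicator_nonneg (fun _ _ => hL0) x
    linarith
  · have hlt : ε < F x - f x := not_le.1 hxε
    rw [h.deriv_truncation_of_lt hlt, Set.indicator_of_mem (show x ∈ {x | ε ≤ F x - f x} from hlt.le)]
    linarith [hL x hlt.le, abs_nonneg (deriv f x)]

lemma hasPrim_truncation (h : Detached f F) {ε : ℝ} (hε : 0 < ε) :
    HasPrim (fun x => max (f x) (F x - ε)) (deriv fun x => max (f x) (F x - ε)) :=
  .of_absolutelyContinuousOnInterval (h.absolutelyContinuousOnInterval_truncation hε)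
    (h.integrable_deriv_truncation hε)

end Detached
-- Variation of the majorant on the shells `ε < F - f ≤ δ`
lemma monotone_sign : Monotone fun y : ℝ => ((SignType.sign y : SignType) : ℝ) := by
  intro x y hxy
  have h1 : ∀ a b : SignType, a ≤ b → (a : ℝ) ≤ b := by
    intro a b hab
    cases a <;> cases b <;> simp_all
  exact h1 _ _ (SignType.sign.monotone hxy)

/-- Formally `∫ m η' = -∫ m' η ≤ 0`, since `m' ≥ 0` on the support of `η`. As `m` is merely bounded
and measurable, it is replaced by the difference quotients `s⁻¹ (M(x+s) - M(x))` of its primitive: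
these are Lipschitz, so integration by parts applies, they are bounded by one, and they tend to `m`
almost everywhere as `s → 0`. -/
lemma integral_mul_le_zero_of_monotone {m η η' : ℝ → ℝ} {R r : ℝ} (hm : Measurable m)
    (hm1 : ∀ x, |m x| ≤ 1) (hη : HasPrim η η') (hη0 : ∀ x, 0 ≤ η x) (hR : 0 ≤ R)
    (hηR : ∀ x, R ≤ |x| → η x = 0) (hr : 0 < r)
    (hmono : ∀ s, 0 < s → s ≤ r → ∀ᵐ x, η x ≠ 0 → m x ≤ m (x + s)) :
    ∫ x in -R..R, m x * η' x ≤ 0 := by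
  have hmi : LocallyIntegrable m volume :=
    (locallyIntegrable_const (1 : ℝ)).mono hm.aestronglyMeasurable
      (ae_of_all _ fun x => by simpa using hm1 x)
  have hmint : ∀ a b, IntervalIntegrable m volume a b := fun a b =>
    (hmi.integrableOn_isCompact isCompact_uIcc).intervalIntegrable
  set M : ℝ → ℝ := fun x => ∫ t in (0 : ℝ)..x, m t with hM
  have hMsub : ∀ x y, M y - M x = ∫ t in x..y, m t := fun x y =>
    intervalIntegral.integral_interval_sub_left (hmint _ _) (hmint _ _)
  have hMlip : ∀ x y, |M y - M x| ≤ |y - x| := fun x y => by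
    rw [hMsub]
    simpa using intervalIntegral.norm_integral_le_of_norm_le_const (C := 1) (a := x) (b := y)
      (f := m) fun t _ => hm1 t
  have hMd : ∀ᵐ x, HasDerivAt M (m x) x := by
    filter_upwards [_root_.LocallyIntegrable.ae_hasDerivAt_integral hmi] with x hx using hx 0
  have hbd : ∀ s, 0 < s → ∀ x, |s⁻¹ * (M (x + s) - M x)| ≤ 1 := by
    intro s hs x
    have := hMlip x (x + s)
    rw [add_sub_cancel_left, abs_of_pos hs] at this
    rw [abs_mul, abs_inv, abs_of_pos hs, inv_mul_le_iff₀ hs]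
    simpa using this
  have hcont : Continuous M := by
    have : LipschitzWith 1 M := LipschitzWith.of_dist_le_mul fun x y => by
      simpa [Real.dist_eq] using hMlip y x
    exact this.continuous
  have hstep : ∀ s, 0 < s → s ≤ r → ∫ x in -R..R, (s⁻¹ * (M (x + s) - M x)) * deriv η x ≤ 0 := by
    intro s hs hsr
    have hlip : LipschitzWith (2 / s).toNNReal fun x => s⁻¹ * (M (x + s) - M x) := by
      refine LipschitzWith.of_dist_le' fun x y => ?_
      simp only [Real.dist_eq]
      have h1 := hMlip (y + s) (x + s)
      have h2 := hMlip x y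
      rw [add_sub_add_right_eq_sub] at h1
      rw [abs_sub_comm y x] at h2
      rw [← mul_sub, abs_mul, abs_inv, abs_of_pos hs, div_mul_eq_mul_div, inv_mul_le_iff₀ hs,
        mul_div_cancel₀ _ hs.ne']
      calc |M (x + s) - M x - (M (y + s) - M y)|
          = |(M (x + s) - M (y + s)) + (M y - M x)| := by ring_nf
        _ ≤ |M (x + s) - M (y + s)| + |M y - M x| := abs_add_le _ _
        _ ≤ 2 * |x - y| := by linarith
    have hac : AbsolutelyContinuousOnInterval (fun x => s⁻¹ * (M (x + s) - M x)) (-R) R :=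
      hlip.lipschitzOnWith.absolutelyContinuousOnInterval
    -- The boundary terms vanish because `η` is zero at `±R`.
    rw [hac.integral_mul_deriv_eq_deriv_mul (hη.absolutelyContinuousOnInterval _ _),
      hηR R (le_abs_self R), hηR (-R) (by rw [abs_neg]; exact le_abs_self R), mul_zero, mul_zero,
      sub_zero, zero_sub, neg_nonpos]
    refine intervalIntegral.integral_nonneg_of_ae (by linarith) ?_
    have hMd' : ∀ᵐ x, HasDerivAt M (m (x + s)) (x + s) :=
      (measurePreserving_add_right volume s).quasiMeasurePreserving.ae hMd
    filter_upwards [hMd, hMd', hmono s hs hsr] with x h1 h2 h3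
    have h4 : HasDerivAt (fun x => s⁻¹ * (M (x + s) - M x)) (s⁻¹ * (m (x + s) - m x)) x :=
      ((h2.comp_add_const x s).sub h1).const_mul _
    rw [h4.deriv, Pi.zero_apply]
    rcases eq_or_ne (η x) 0 with h0 | h0
    · rw [h0, mul_zero]
    · exact mul_nonneg (mul_nonneg (inv_nonneg.2 hs.le) (sub_nonneg.2 (h3 h0))) (hη0 x)
  have hs0 : Tendsto (fun n : ℕ => r / ((n : ℝ) + 1)) atTop (𝓝 0) := by
    simpa [div_eq_mul_inv] using (tendsto_one_div_add_atTop_nhds_zero_nat (𝕜 := ℝ)).const_mul r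
  have hspos : ∀ n : ℕ, 0 < r / ((n : ℝ) + 1) := fun n => by positivity
  have hlim : Tendsto (fun n : ℕ => ∫ x in -R..R,
      ((r / ((n : ℝ) + 1))⁻¹ * (M (x + r / ((n : ℝ) + 1)) - M x)) * deriv η x) atTop
      (𝓝 (∫ x in -R..R, m x * deriv η x)) := by
    refine intervalIntegral.tendsto_integral_filter_of_dominated_convergence (fun x => |deriv η x|)
      (Eventually.of_forall fun n => ?_) (Eventually.of_forall fun n => ae_of_all _ fun x _ => ?_)
      hη.integrable_deriv.abs.intervalIntegrable ?_
    · refine Measurable.aestronglyMeasurable ?_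
      exact (Continuous.measurable (by fun_prop)).mul (measurable_deriv η)
    · rw [norm_mul]
      exact mul_le_of_le_one_left (norm_nonneg _) (hbd _ (hspos n) x)
    · filter_upwards [hMd] with x hx _
      refine Tendsto.mul_const _ ?_
      have h1 := (hasDerivAt_iff_tendsto_slope_zero.1 hx).comp
        (tendsto_nhdsWithin_iff.2 ⟨hs0, Eventually.of_forall fun n => (hspos n).ne'⟩)
      exact h1
  have hle : ∫ x in -R..R, m x * deriv η x ≤ 0 := by
    refine le_of_tendsto' hlim fun n => hstep _ (hspos n) ?_
    exact div_le_self hr.le (by linarith [Nat.cast_nonneg (α := ℝ) n])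
  rwa [intervalIntegral.integral_congr_ae (g := fun x => m x * deriv η x)
    (hη.deriv_ae_eq.mono fun x hx _ => by rw [hx])]

namespace Detached

variable {f F : ℝ → ℝ}

lemma ae_differentiableAt_of_lt (h : Detached f F) {ε : ℝ} (hε : 0 < ε) :
    ∀ᵐ x, ε < F x - f x → DifferentiableAt ℝ F x := by
  filter_upwards [ae_differentiableAt_of_absolutelyContinuousOnInterval
    (h.absolutelyContinuousOnInterval_truncation hε)] with x hx hlt
  have h1 := ((h.truncation_eventuallyEq_of_lt hlt).differentiableAt_iff.1 hx).add_const ε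
  simpa using h1

/-- With `m = sign F'` and `η = max(f, F-ε) - max(f, F-δ)`, the product `m η'` equals `|F'| - m f'`
on the shell and zero elsewhere. Convexity of `F` near the support of `η` makes `∫ m η' ≤ 0`, and `m
f' ≤ |f'|`. -/
lemma setIntegral_abs_deriv_le (h : Detached f F) {ε δ : ℝ} (hε : 0 < ε) (hεδ : ε ≤ δ) :
    ∫ x in {x | ε < F x - f x ∧ F x - f x ≤ δ}, |deriv F x| ≤
      ∫ x in {x | ε < F x - f x ∧ F x - f x ≤ δ}, |deriv f x| := by
  set E : Set ℝ := {x | ε < F x - f x ∧ F x - f x ≤ δ} with hE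
  have hδ : 0 < δ := hε.trans_le hεδ
  have hEm : MeasurableSet E :=
    (measurableSet_lt measurable_const h.continuous_sub.measurable).inter
      (measurableSet_le h.continuous_sub.measurable measurable_const)
  obtain ⟨R, hR, hKR⟩ : ∃ R, 0 ≤ R ∧ ∀ x, ε ≤ F x - f x → |x| < R := by
    obtain ⟨R, hR, hsub⟩ := (h.isCompact ε hε).isBounded.subset_ball_lt 0 0
    exact ⟨R, hR.le, fun x hx => by simpa using hsub hx⟩
  obtain ⟨L, hL0, hL⟩ := h.exists_abs_deriv_le hε
  set m : ℝ → ℝ := fun x => ((SignType.sign (deriv F x) : SignType) : ℝ) with hmdef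
  have hm : Measurable m := monotone_sign.measurable.comp (measurable_deriv F)
  have hm1 : ∀ x, |m x| ≤ 1 := fun x => by
    simp only [hmdef]
    generalize SignType.sign (deriv F x) = a
    cases a <;> simp
  set G : ℝ → ℝ → ℝ := fun e x => max (f x) (F x - e) with hG
  have hη := (h.hasPrim_truncation hε).sub (h.hasPrim_truncation hδ)
  obtain ⟨r, hr, hrad⟩ := h.exists_radius hε
  have hsmall : ∀ x, F x - f x < ε → G ε x - G δ x = 0 := fun x hx => by
    simp only [hG]
    rw [max_eq_left (by linarith), max_eq_left (by linarith), sub_self]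
  have key := integral_mul_le_zero_of_monotone hm hm1 hη
    (fun x => sub_nonneg.2 (max_le_max le_rfl (by linarith))) hR
    (fun x hx => hsmall x (not_le.1 fun h1 => absurd (hKR x h1) (not_lt.2 hx))) hr ?_
  · have hη' : ∀ᵐ x, m x * (deriv (fun x => max (f x) (F x - ε)) x -
        deriv (fun x => max (f x) (F x - δ)) x) =
        E.indicator (fun x => |deriv F x| - m x * deriv f x) x := by
      filter_upwards [h.ae_deriv_truncation_of_le hε, h.ae_deriv_truncation_of_le hδ] with x h1 h2
      by_cases hx : x ∈ E
      · rw [Set.indicator_of_mem hx, h2 hx.2, h.deriv_truncation_of_lt hx.1, mul_sub]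
        simp only [hmdef]
        rw [sign_mul_self]
      · rw [Set.indicator_of_notMem hx]
        by_cases hxε : F x - f x ≤ ε
        · rw [h1 hxε, h2 (hxε.trans hεδ), sub_self, mul_zero]
        · have hxδ : δ < F x - f x := by
            by_contra hc
            exact hx ⟨not_le.1 hxε, not_lt.1 hc⟩
          rw [h.deriv_truncation_of_lt (not_le.1 hxε), h.deriv_truncation_of_lt hxδ, sub_self,
            mul_zero]
    rw [intervalIntegral.integral_congr_ae (hη'.mono fun x hx _ => hx),
      intervalIntegral.integral_of_le (by linarith), setIntegral_indicator hEm,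
      Set.inter_eq_right.2 fun x hx => ?_] at key
    · have hiF : IntegrableOn (fun x => |deriv F x|) E volume := by
        have hfin : volume E ≠ ⊤ :=
          ((measure_mono fun x hx => hx.1.le).trans_lt (h.isCompact ε hε).measure_lt_top).ne
        refine (integrableOn_const (C := L) hfin).mono' (measurable_deriv F).abs.aestronglyMeasurable ?_
        filter_upwards [ae_restrict_mem hEm] with x hx
        rw [Real.norm_eq_abs, abs_abs]
        exact hL x hx.1.le
      have hif : IntegrableOn (fun x => |deriv f x|) E volume := h.hasPrim.integrable.abs.integrableOn
      have him : IntegrableOn (fun x => m x * deriv f x) E volume := by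
        refine hif.mono' (hm.mul (measurable_deriv f)).aestronglyMeasurable (ae_of_all _ fun x => ?_)
        rw [norm_mul]
        exact mul_le_of_le_one_left (norm_nonneg _) (hm1 x)
      rw [integral_sub hiF him] at key
      refine (sub_nonpos.1 key).trans (setIntegral_mono him hif fun x => ?_)
      refine (le_abs_self _).trans ?_
      simp only [abs_mul]
      exact mul_le_of_le_one_left (abs_nonneg _) (hm1 x)
    · have := abs_lt.1 (hKR x hx.1.le)
      exact ⟨this.1, this.2.le⟩
  -- Where `η ≠ 0` the gap is at least `ε`, so `F` is convex on `[x-r, x+r]`, and the slope between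
  -- `x` and `x + s` separates the two derivatives.
  · intro s hs hsr
    have hd := h.ae_differentiableAt_of_lt (half_pos hε)
    have hd' : ∀ᵐ x, ε / 2 < F (x + s) - f (x + s) → DifferentiableAt ℝ F (x + s) :=
      (measurePreserving_add_right volume s).quasiMeasurePreserving.ae hd
    filter_upwards [hd, hd'] with x h1 h2 hne
    have hx : ε ≤ F x - f x := not_lt.1 fun hlt => hne (hsmall x hlt)
    have hconv : ConvexOn ℝ (Set.Icc (x - r) (x + r)) F :=
      h.convexOn _ _ fun y hy => by linarith [hrad x hx y hy]
    have hx0 : x ∈ Set.Icc (x - r) (x + r) := ⟨by linarith, by linarith⟩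
    have hxs : x + s ∈ Set.Icc (x - r) (x + r) := ⟨by linarith, by linarith⟩
    have h3 := hconv.deriv_le_slope hx0 hxs (by linarith) (h1 (by linarith))
    have h4 := hconv.slope_le_deriv hx0 hxs (by linarith) (h2 (hrad x hx _ hxs))
    exact monotone_sign (h3.trans h4)

end Detached
-- Absolute continuity of the majorant and the variation inequality on sublevel sets
namespace Detached

variable {f F : ℝ → ℝ}

lemma measurableSet_le (h : Detached f F) (δ : ℝ) : MeasurableSet {x | F x - f x ≤ δ} :=
  _root_.measurableSet_le h.continuous_sub.measurable measurable_const

lemma measurableSet_lt (h : Detached f F) (δ : ℝ) : MeasurableSet {x | δ < F x - f x} :=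
  _root_.measurableSet_lt measurable_const h.continuous_sub.measurable

lemma integrableOn_deriv_of_lt (h : Detached f F) {ε : ℝ} (hε : 0 < ε) :
    IntegrableOn (deriv F) {x | ε < F x - f x} volume := by
  obtain ⟨L, hL0, hL⟩ := h.exists_abs_deriv_le hε
  have hfin : volume {x | ε < F x - f x} ≠ ⊤ :=
    ((measure_mono fun x (hx : ε < F x - f x) => hx.le).trans_lt
      (h.isCompact ε hε).measure_lt_top).ne
  refine (integrableOn_const (C := L) hfin).mono' (measurable_deriv F).aestronglyMeasurable ?_
  filter_upwards [ae_restrict_mem (h.measurableSet_lt ε)] with x hx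
  exact hL x (le_of_lt hx)

/-- Differentiability of `F` at almost every contact point is not yet available; where it fails,
`deriv F` is zero by convention and the bound is trivial. -/
lemma ae_abs_deriv_le_of_le_zero (h : Detached f F) :
    ∀ᵐ x, F x - f x ≤ 0 → |deriv F x| ≤ |deriv f x| := by
  filter_upwards [h.hasPrim.ae_hasDerivAt] with x hf hx
  by_cases hF : DifferentiableAt ℝ F x
  · rw [deriv_eq_of_le_of_eq hf.differentiableAt hF h.le (le_antisymm (h.le x) (by linarith))]
  · rw [deriv_zero_of_not_differentiableAt hF, abs_zero]
    exact abs_nonneg _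

/-- The sublevel set is the contact set together with the increasing union of the shells `1/(n+1) <
F - f ≤ δ`. The integrals are extended-valued because integrability of `F'` is a consequence,
obtained by taking `δ` above the whole gap. -/
lemma setLIntegral_enorm_deriv_le (h : Detached f F) {δ : ℝ} (hδ : 0 < δ) :
    ∫⁻ x in {x | F x - f x ≤ δ}, ‖deriv F x‖ₑ ≤ ∫⁻ x in {x | F x - f x ≤ δ}, ‖deriv f x‖ₑ := by
  set E : ℕ → Set ℝ := fun n => {x | 1 / ((n : ℝ) + 1) < F x - f x ∧ F x - f x ≤ δ} with hE
  have hEm : ∀ n, MeasurableSet (E n) := fun n =>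
    (h.measurableSet_lt _).inter (h.measurableSet_le _)
  have hU : (⋃ n, E n) = {x | 0 < F x - f x ∧ F x - f x ≤ δ} := by
    ext x
    simp only [hE, Set.mem_iUnion, Set.mem_ofPred_eq]
    constructor
    · rintro ⟨n, h1, h2⟩
      exact ⟨lt_trans (by positivity) h1, h2⟩
    · rintro ⟨h1, h2⟩
      obtain ⟨n, hn⟩ := exists_nat_one_div_lt h1
      exact ⟨n, hn, h2⟩
  have hdir : Monotone E := by
    intro n k hnk x hx
    refine ⟨lt_of_le_of_lt ?_ hx.1, hx.2⟩
    exact one_div_le_one_div_of_le (by positivity) (by exact_mod_cast Nat.succ_le_succ hnk)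
  have hsplit : {x | F x - f x ≤ δ} = {x | F x - f x ≤ 0} ∪ ⋃ n, E n := by
    rw [hU]
    ext x
    simp only [Set.mem_union, Set.mem_ofPred_eq]
    constructor
    · intro hx
      rcases le_or_gt (F x - f x) 0 with h0 | h0
      · exact Or.inl h0
      · exact Or.inr ⟨h0, hx⟩
    · rintro (hx | hx)
      · exact hx.trans hδ.le
      · exact hx.2
  have hdisj : Disjoint {x | F x - f x ≤ 0} (⋃ n, E n) := by
    rw [hU, Set.disjoint_left]
    intro x hx hx'
    exact absurd hx'.1 (not_lt.2 hx)
  rw [hsplit, lintegral_union (MeasurableSet.iUnion hEm) hdisj,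
    lintegral_union (MeasurableSet.iUnion hEm) hdisj]
  refine add_le_add ?_ ?_
  · refine lintegral_mono_ae ?_
    filter_upwards [ae_restrict_of_ae h.ae_abs_deriv_le_of_le_zero,
      ae_restrict_mem (h.measurableSet_le 0)] with x hx hx0
    exact enorm_le_iff_norm_le.2 (hx hx0)
  · rw [setLIntegral_iUnion_of_directed _ hdir.directed_le]
    refine iSup_le fun n => le_trans ?_ (lintegral_mono_set (Set.subset_iUnion E n))
    rcases le_or_gt (1 / ((n : ℝ) + 1)) δ with hn | hn
    · have hpos : 0 < 1 / ((n : ℝ) + 1) := by positivity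
      have h1 := h.setIntegral_abs_deriv_le hpos hn
      have hiF : IntegrableOn (deriv F) (E n) volume :=
        (h.integrableOn_deriv_of_lt hpos).mono_set fun x hx => hx.1
      have hif : IntegrableOn (deriv f) (E n) volume := h.hasPrim.integrable.integrableOn
      rw [← ofReal_integral_norm_eq_lintegral_enorm hiF,
        ← ofReal_integral_norm_eq_lintegral_enorm hif]
      exact ENNReal.ofReal_le_ofReal h1
    · have : E n = ∅ := by
        ext x
        simp only [hE, Set.mem_ofPred_eq, Set.mem_empty_iff_false, iff_false]
        rintro ⟨h1, h2⟩
        linarith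
      simp [this]

lemma exists_sub_le (h : Detached f F) : ∃ δ, 0 < δ ∧ ∀ x, F x - f x ≤ δ := by
  obtain ⟨C, hC⟩ := (h.isCompact 1 one_pos).exists_bound_of_continuousOn
    h.continuous_sub.continuousOn
  refine ⟨max C 1, lt_max_of_lt_right one_pos, fun x => ?_⟩
  rcases le_or_gt 1 (F x - f x) with hx | hx
  · exact ((le_abs_self _).trans (hC x hx)).trans (le_max_left _ _)
  · exact hx.le.trans (le_max_right _ _)

lemma integrable_deriv (h : Detached f F) : Integrable (deriv F) volume := by
  obtain ⟨δ, hδ, H⟩ := h.exists_sub_le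
  have h1 := h.setLIntegral_enorm_deriv_le hδ
  have hu : {x | F x - f x ≤ δ} = Set.univ := Set.eq_univ_of_forall H
  rw [hu, Measure.restrict_univ] at h1
  exact ⟨(measurable_deriv F).aestronglyMeasurable, h1.trans_lt h.hasPrim.integrable.2⟩

/-- A function that is convex off the contact set with an absolutely continuous minorant is
absolutely continuous. -/
lemma hasPrim_right (h : Detached f F) : HasPrim F (deriv F) := by
  have hpos : ∀ n : ℕ, 0 < 1 / ((n : ℝ) + 1) := fun n => by positivity
  have hlim : Tendsto (fun n : ℕ => 1 / ((n : ℝ) + 1)) atTop (𝓝 0) :=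
    tendsto_one_div_add_atTop_nhds_zero_nat
  set H : ℝ → ℝ := fun x => if 0 < F x - f x then deriv F x else deriv f x with hH
  have hae : ∀ᵐ x, ∀ n : ℕ, deriv (fun x => max (f x) (F x - 1 / ((n : ℝ) + 1))) x =
      if 1 / ((n : ℝ) + 1) < F x - f x then deriv F x else deriv f x := by
    refine ae_all_iff.2 fun n => ?_
    filter_upwards [h.ae_deriv_truncation_of_le (hpos n)] with x hx
    split_ifs with hc
    · exact h.deriv_truncation_of_lt hc
    · exact hx (not_lt.1 hc)
  have key : HasPrim F H := by
    -- The truncations at levels `1/(n+1)` converge to `F`, and each of their derivatives is `F'` or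
    -- `f'`, hence dominated by the integrable `|F'| + |f'|`.
    refine HasPrim.of_tendsto (b := fun x => |deriv F x| + |deriv f x|)
      (fun n => h.hasPrim_truncation (hpos n)) (fun x => ?_) ?_
      (h.integrable_deriv.abs.add h.hasPrim.integrable.abs) (fun n => ?_)
    · have h1 : Tendsto (fun n : ℕ => max (f x) (F x - 1 / ((n : ℝ) + 1))) atTop
          (𝓝 (max (f x) (F x - 0))) := tendsto_const_nhds.max (hlim.const_sub _)
      rwa [sub_zero, max_eq_right (h.le x)] at h1
    · filter_upwards [hae] with x hx
      simp only [hx, hH]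
      split_ifs with hc
      · refine tendsto_const_nhds.congr' ?_
        filter_upwards [hlim.eventually (gt_mem_nhds hc)] with n hn
        rw [if_pos hn]
      · refine tendsto_const_nhds.congr fun n => ?_
        rw [if_neg fun h1 => hc ((hpos n).trans h1)]
    · filter_upwards [hae] with x hx
      rw [hx n]
      split_ifs
      · linarith [abs_nonneg (deriv f x)]
      · linarith [abs_nonneg (deriv F x)]
  exact key.hasPrim_deriv

lemma setIntegral_abs_deriv_le_of_le (h : Detached f F) {δ : ℝ} (hδ : 0 < δ) :
    ∫ x in {x | F x - f x ≤ δ}, |deriv F x| ≤ ∫ x in {x | F x - f x ≤ δ}, |deriv f x| := by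
  have h1 := h.setLIntegral_enorm_deriv_le hδ
  rw [← ofReal_integral_norm_eq_lintegral_enorm h.integrable_deriv.integrableOn,
    ← ofReal_integral_norm_eq_lintegral_enorm h.hasPrim.integrable.integrableOn,
    ENNReal.ofReal_le_ofReal_iff (integral_nonneg fun x => norm_nonneg _)] at h1
  exact h1

lemma ae_deriv_eq_of_le_zero (h : Detached f F) :
    ∀ᵐ x, F x - f x ≤ 0 → deriv f x = deriv F x := by
  filter_upwards [h.hasPrim.ae_hasDerivAt, h.hasPrim_right.ae_hasDerivAt] with x hf hF hx
  exact deriv_eq_of_le_of_eq hf.differentiableAt hF.differentiableAt h.le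
    (le_antisymm (h.le x) (by linarith))

end Detached

/-! ### Convergence of total variations -/

/-- By convexity the derivative of `F j` at `x` lies between its left and right slopes. For fixed
nearby points these slopes converge, and those of `F₀` are close to its derivative. -/
lemma tendsto_deriv_of_convexOn {F : ℕ → ℝ → ℝ} {F₀ : ℝ → ℝ} {x r : ℝ} (hr : 0 < r)
    (hF : ∀ᶠ j in atTop, ConvexOn ℝ (Set.Icc (x - r) (x + r)) (F j))
    (hd : ∀ j, DifferentiableAt ℝ (F j) x) (hd₀ : DifferentiableAt ℝ F₀ x)
    (hlim : ∀ y, Tendsto (fun j => F j y) atTop (𝓝 (F₀ y))) :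
    Tendsto (fun j => deriv (F j) x) atTop (𝓝 (deriv F₀ x)) := by
  have hs := hasDerivAt_iff_tendsto_slope.1 hd₀.hasDerivAt
  have hx : x ∈ Set.Icc (x - r) (x + r) := ⟨by linarith, by linarith⟩
  have hsl : ∀ y z, Tendsto (fun j => slope (F j) y z) atTop (𝓝 (slope F₀ y z)) := fun y z => by
    simp only [slope, vsub_eq_sub]
    exact ((hlim z).sub (hlim y)).const_smul _
  refine tendsto_order.2 ⟨fun a ha => ?_, fun b hb => ?_⟩
  · have h1 : ∀ᶠ y in 𝓝[<] x, a < slope F₀ x y :=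
      (hs.mono_left (nhdsWithin_mono x fun y (hy : y < x) => hy.ne)).eventually (lt_mem_nhds ha)
    obtain ⟨y, hy1, hy2⟩ := (h1.and (Ioo_mem_nhdsLT (show x - r < x by linarith))).exists
    rw [slope_comm] at hy1
    filter_upwards [hF, (hsl y x).eventually (lt_mem_nhds hy1)] with j hj hlt
    exact hlt.trans_le (hj.slope_le_deriv ⟨hy2.1.le, by linarith [hy2.2]⟩ hx hy2.2 (hd j))
  · have h1 : ∀ᶠ y in 𝓝[>] x, slope F₀ x y < b :=
      (hs.mono_left (nhdsWithin_mono x fun y (hy : x < y) => hy.ne')).eventually (gt_mem_nhds hb)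
    obtain ⟨y, hy1, hy2⟩ := (h1.and (Ioo_mem_nhdsGT (show x < x + r by linarith))).exists
    filter_upwards [hF, (hsl x y).eventually (gt_mem_nhds hy1)] with j hj hlt
    exact (hj.deriv_le_slope hx ⟨by linarith [hy2.1], hy2.2.le⟩ hy2.1 (hd j)).trans_lt hlt

/-- A difference quotient is an average of translates of the derivative; apply Tonelli and
translation invariance. -/
lemma HasPrim.lintegral_enorm_slope_le {F G : ℝ → ℝ} (h : HasPrim F G) {s : ℝ} (hs : 0 < s) :
    ∫⁻ x, ‖s⁻¹ * (F (x + s) - F x)‖ₑ ≤ ∫⁻ x, ‖deriv F x‖ₑ := by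
  have h' := h.hasPrim_deriv
  have h1 : ∀ x, ‖F (x + s) - F x‖ₑ ≤ ∫⁻ t in Set.Ioc 0 s, ‖deriv F (x + t)‖ₑ := by
    intro x
    have h2 : F (x + s) - F x = ∫ t in Set.Ioc 0 s, deriv F (x + t) := by
      rw [← intervalIntegral.integral_of_le hs.le,
        intervalIntegral.integral_comp_add_left (f := deriv F) x, add_zero, ← h'.sub_eq]
    rw [h2]
    exact enorm_integral_le_lintegral_enorm _
  have hm : Measurable fun p : ℝ × ℝ => ‖deriv F (p.1 + p.2)‖ₑ :=
    ((measurable_deriv F).comp (measurable_fst.add measurable_snd)).enorm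
  have h3 : ∫⁻ x, ‖F (x + s) - F x‖ₑ ≤ ENNReal.ofReal s * ∫⁻ x, ‖deriv F x‖ₑ := by
    calc ∫⁻ x, ‖F (x + s) - F x‖ₑ ≤ ∫⁻ x, ∫⁻ t in Set.Ioc 0 s, ‖deriv F (x + t)‖ₑ :=
          lintegral_mono h1
      _ = ∫⁻ t in Set.Ioc 0 s, ∫⁻ x, ‖deriv F (x + t)‖ₑ :=
          lintegral_lintegral_swap hm.aemeasurable
      _ = ∫⁻ _ in Set.Ioc 0 s, ∫⁻ x, ‖deriv F x‖ₑ := by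
          refine lintegral_congr fun t => ?_
          exact lintegral_add_right_eq_self (μ := volume) (fun x => ‖deriv F x‖ₑ) t
      _ = ENNReal.ofReal s * ∫⁻ x, ‖deriv F x‖ₑ := by
          rw [setLIntegral_const, Real.volume_Ioc, sub_zero, mul_comm]
  have h4 : ∀ x, ‖s⁻¹ * (F (x + s) - F x)‖ₑ = ‖s⁻¹‖ₑ * ‖F (x + s) - F x‖ₑ := fun x => enorm_mul _ _
  simp only [h4]
  rw [lintegral_const_mul' _ _ enorm_ne_top]
  refine (mul_le_mul_right h3 _).trans ?_
  rw [← mul_assoc, Real.enorm_of_nonneg (inv_nonneg.2 hs.le),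
    ← ENNReal.ofReal_mul (inv_nonneg.2 hs.le), inv_mul_cancel₀ hs.ne', ENNReal.ofReal_one, one_mul]

/-- Lower semicontinuity of the variation under pointwise convergence: Fatou in `j` at fixed step
`s`, then Fatou again as `s → 0`. -/
lemma HasPrim.lintegral_enorm_deriv_le_liminf {F : ℕ → ℝ → ℝ} {G : ℕ → ℝ → ℝ} {F₀ G₀ : ℝ → ℝ}
    (h : ∀ j, HasPrim (F j) (G j)) (h₀ : HasPrim F₀ G₀)
    (hlim : ∀ y, Tendsto (fun j => F j y) atTop (𝓝 (F₀ y))) :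
    ∫⁻ x, ‖deriv F₀ x‖ₑ ≤ liminf (fun j => ∫⁻ x, ‖deriv (F j) x‖ₑ) atTop := by
  have h1 : ∀ s, 0 < s → ∫⁻ x, ‖s⁻¹ * (F₀ (x + s) - F₀ x)‖ₑ ≤
      liminf (fun j => ∫⁻ x, ‖deriv (F j) x‖ₑ) atTop := by
    intro s hs
    have h2 : ∀ x, ‖s⁻¹ * (F₀ (x + s) - F₀ x)‖ₑ =
        liminf (fun j => ‖s⁻¹ * (F j (x + s) - F j x)‖ₑ) atTop := fun x =>
      ((((hlim (x + s)).sub (hlim x)).const_mul s⁻¹).enorm).liminf_eq.symm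
    simp only [h2]
    refine (lintegral_liminf_le fun j => ?_).trans
      (liminf_le_liminf (Eventually.of_forall fun j => (h j).lintegral_enorm_slope_le hs))
    have := (h j).continuous
    exact Measurable.enorm (Continuous.measurable (by fun_prop))
  have hs0 : Tendsto (fun n : ℕ => 1 / ((n : ℝ) + 1)) atTop (𝓝 0) :=
    tendsto_one_div_add_atTop_nhds_zero_nat
  have hspos : ∀ n : ℕ, 0 < 1 / ((n : ℝ) + 1) := fun n => by positivity
  calc ∫⁻ x, ‖deriv F₀ x‖ₑ
      = ∫⁻ x, liminf (fun n : ℕ => ‖(1 / ((n : ℝ) + 1))⁻¹ *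
          (F₀ (x + 1 / ((n : ℝ) + 1)) - F₀ x)‖ₑ) atTop := by
        refine lintegral_congr_ae ?_
        filter_upwards [h₀.hasPrim_deriv.ae_hasDerivAt] with x hx
        have h2 := (hasDerivAt_iff_tendsto_slope_zero.1 hx).comp
          (tendsto_nhdsWithin_iff.2 ⟨hs0, Eventually.of_forall fun n => (hspos n).ne'⟩)
        exact h2.enorm.liminf_eq.symm
    _ ≤ liminf (fun n : ℕ => ∫⁻ x, ‖(1 / ((n : ℝ) + 1))⁻¹ *
          (F₀ (x + 1 / ((n : ℝ) + 1)) - F₀ x)‖ₑ) atTop := by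
        refine lintegral_liminf_le fun n => ?_
        have := h₀.continuous
        exact Measurable.enorm (Continuous.measurable (by fun_prop))
    _ ≤ liminf (fun _ : ℕ => liminf (fun j => ∫⁻ x, ‖deriv (F j) x‖ₑ) atTop) atTop :=
        liminf_le_liminf (Eventually.of_forall fun n => h1 _ (hspos n))
    _ = liminf (fun j => ∫⁻ x, ‖deriv (F j) x‖ₑ) atTop := liminf_const _

lemma HasPrim.eventually_lt_integral_abs_deriv {F : ℕ → ℝ → ℝ} {G : ℕ → ℝ → ℝ} {F₀ G₀ : ℝ → ℝ}
    (h : ∀ j, HasPrim (F j) (G j)) (h₀ : HasPrim F₀ G₀)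
    (hlim : ∀ y, Tendsto (fun j => F j y) atTop (𝓝 (F₀ y))) {a : ℝ}
    (ha : a < ∫ x, |deriv F₀ x|) : ∀ᶠ j in atTop, a < ∫ x, |deriv (F j) x| := by
  rcases lt_or_ge a 0 with ha0 | ha0
  · exact Eventually.of_forall fun j => ha0.trans_le (integral_nonneg fun x => abs_nonneg _)
  have h1 := HasPrim.lintegral_enorm_deriv_le_liminf h h₀ hlim
  rw [← ofReal_integral_norm_eq_lintegral_enorm h₀.integrable_deriv] at h1
  have h2 : ENNReal.ofReal a < liminf (fun j => ∫⁻ x, ‖deriv (F j) x‖ₑ) atTop :=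
    ((ENNReal.ofReal_lt_ofReal_iff_of_nonneg ha0).2 ha).trans_le h1
  filter_upwards [eventually_lt_of_lt_liminf h2] with j hj
  rw [← ofReal_integral_norm_eq_lintegral_enorm (h j).integrable_deriv,
    ENNReal.ofReal_lt_ofReal_iff_of_nonneg ha0] at hj
  exact hj

section Convergence

variable {f F : ℕ → ℝ → ℝ} {f₀ F₀ : ℝ → ℝ} {c : ℕ → ℝ}

lemma tendsto_of_abs_sub_le (hc : Tendsto c atTop (𝓝 0)) (hF : ∀ j x, |F j x - F₀ x| ≤ c j)
    (y : ℝ) : Tendsto (fun j => F j y) atTop (𝓝 (F₀ y)) :=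
  tendsto_iff_dist_tendsto_zero.2 (squeeze_zero (fun _ => dist_nonneg) (fun j => hF j y) hc)

/-- Uniform convergence keeps `F j - f j` positive within a fixed distance of the points of the set,
so eventually all `F j` are convex there on intervals of one length. This gives pointwise
convergence of derivatives and a common Lipschitz bound on a set of finite measure. -/
lemma Detached.tendsto_setIntegral_abs_deriv (h : ∀ j, Detached (f j) (F j))
    (h₀ : Detached f₀ F₀) (hc : Tendsto c atTop (𝓝 0)) (hf : ∀ j x, |f j x - f₀ x| ≤ c j)
    (hF : ∀ j x, |F j x - F₀ x| ≤ c j) {ε : ℝ} (hε : 0 < ε) :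
    Tendsto (fun j => ∫ x in {x | ε < F₀ x - f₀ x}, |deriv (F j) x|) atTop
      (𝓝 (∫ x in {x | ε < F₀ x - f₀ x}, |deriv F₀ x|)) := by
  obtain ⟨r, hr, hrad⟩ := h₀.exists_radius hε
  obtain ⟨B, hB⟩ := h₀.bounded
  have hfin : volume {x | ε < F₀ x - f₀ x} ≠ ⊤ :=
    ((measure_mono fun x (hx : ε < F₀ x - f₀ x) => hx.le).trans_lt
      (h₀.isCompact ε hε).measure_lt_top).ne
  have hconv : ∀ᶠ j in atTop, ∀ x, ε < F₀ x - f₀ x →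
      ConvexOn ℝ (Set.Icc (x - r) (x + r)) (F j) := by
    filter_upwards [hc.eventually (gt_mem_nhds (show (0 : ℝ) < ε / 4 by positivity))] with j hj x hx
    refine (h j).convexOn _ _ fun y hy => ?_
    have h1 := hrad x hx.le y hy
    have h2 := abs_le.1 (hf j y)
    have h3 := abs_le.1 (hF j y)
    linarith [h2.2, h3.1]
  have hbd : ∀ᶠ j in atTop, ∀ x, |F j x| ≤ B + 1 := by
    filter_upwards [hc.eventually (gt_mem_nhds one_pos)] with j hj x
    have h1 := hF j x
    have h2 := hB x
    have h3 : |F j x| ≤ |F j x - F₀ x| + |F₀ x| := by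
      simpa using abs_add_le (F j x - F₀ x) (F₀ x)
    linarith
  refine tendsto_integral_filter_of_dominated_convergence
    (fun _ => ((4 * (B + 1) / r).toNNReal : ℝ))
    (Eventually.of_forall fun j => (measurable_deriv _).abs.aestronglyMeasurable) ?_
    (integrableOn_const hfin) ?_
  · filter_upwards [hconv, hbd] with j hj hj'
    filter_upwards [ae_restrict_mem (h₀.measurableSet_lt ε)] with x hx
    rw [Real.norm_eq_abs, abs_abs]
    exact norm_deriv_le_of_lipschitzOn (Metric.ball_mem_nhds x (half_pos hr))
      (lipschitzOnWith_ball_of_convexOn_Icc hr (hj x hx) hj')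
  · have hd : ∀ᵐ x, ∀ j, DifferentiableAt ℝ (F j) x := ae_all_iff.2 fun j =>
      (h j).hasPrim_right.ae_hasDerivAt.mono fun x hx => hx.differentiableAt
    filter_upwards [ae_restrict_mem (h₀.measurableSet_lt ε), ae_restrict_of_ae hd,
      ae_restrict_of_ae h₀.hasPrim_right.ae_hasDerivAt] with x hx hdx hd₀
    exact (tendsto_deriv_of_convexOn hr (hconv.mono fun j hj => hj x hx) hdx hd₀.differentiableAt
      (tendsto_of_abs_sub_le hc hF)).abs

lemma Detached.exists_setIntegral_le (h₀ : Detached f₀ F₀) {p : ℝ → ℝ}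
    (hp : Integrable p volume) {e : ℝ} (he : 0 < e) :
    ∃ δ, 0 < δ ∧ ∫ x in {x | F₀ x - f₀ x ≤ δ}, p x < (∫ x in {x | F₀ x - f₀ x ≤ 0}, p x) + e := by
  have hlim : Tendsto (fun n : ℕ => ∫ x in {x | F₀ x - f₀ x ≤ 1 / ((n : ℝ) + 1)}, p x) atTop
      (𝓝 (∫ x in ⋂ n : ℕ, {x | F₀ x - f₀ x ≤ 1 / ((n : ℝ) + 1)}, p x)) := by
    refine tendsto_setIntegral_of_antitone (fun n => h₀.measurableSet_le _) ?_
      ⟨0, hp.integrableOn⟩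
    intro n k hnk x (hx : F₀ x - f₀ x ≤ _)
    exact hx.trans (one_div_le_one_div_of_le (by positivity)
      (by exact_mod_cast Nat.succ_le_succ hnk))
  have hset : ⋂ n : ℕ, {x | F₀ x - f₀ x ≤ 1 / ((n : ℝ) + 1)} = {x | F₀ x - f₀ x ≤ 0} := by
    ext x
    simp only [Set.mem_iInter, Set.mem_ofPred_eq]
    constructor
    · intro hx
      exact ge_of_tendsto' tendsto_one_div_add_atTop_nhds_zero_nat hx
    · intro hx n
      exact hx.trans (by positivity)
  rw [hset] at hlim
  obtain ⟨n, hn⟩ := (hlim.eventually (gt_mem_nhds (lt_add_of_pos_right _ he))).exists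
  exact ⟨_, by positivity, hn⟩

/-- Uniform convergence of detached pairs together with `L¹` control of the derivatives of the
minorants implies convergence of the total variations of the majorants. -/
theorem Detached.tendsto_integral_abs_deriv {p : ℕ → ℝ → ℝ} {p₀ : ℝ → ℝ}
    (h : ∀ j, Detached (f j) (F j)) (h₀ : Detached f₀ F₀) (hc : Tendsto c atTop (𝓝 0))
    (hf : ∀ j x, |f j x - f₀ x| ≤ c j) (hF : ∀ j x, |F j x - F₀ x| ≤ c j)
    (hp : ∀ j, Integrable (p j) volume) (hp₀ : Integrable p₀ volume)
    (hfp : ∀ j, ∀ᵐ x, |deriv (f j) x| ≤ p j x) (hfp₀ : ∀ᵐ x, p₀ x = |deriv f₀ x|)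
    (hpp : Tendsto (fun j => ∫ x, |p j x - p₀ x|) atTop (𝓝 0)) :
    Tendsto (fun j => ∫ x, |deriv (F j) x|) atTop (𝓝 (∫ x, |deriv F₀ x|)) := by
  refine tendsto_order.2 ⟨fun a ha => HasPrim.eventually_lt_integral_abs_deriv
    (fun j => (h j).hasPrim_right) h₀.hasPrim_right (tendsto_of_abs_sub_le hc hF) ha,
    fun b hb => ?_⟩
  -- Three errors of size `e`: the `L¹` distance of `p j` to `p₀`, the passage from the contact set
  -- to a sublevel set, and the convergence away from contact.
  set e : ℝ := (b - ∫ x, |deriv F₀ x|) / 3 with he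
  have he0 : 0 < e := by rw [he]; linarith
  obtain ⟨δ', hδ', hδp⟩ := h₀.exists_setIntegral_le hp₀ he0
  set δ : ℝ := δ' / 2 with hδ
  have hδ0 : 0 < δ := half_pos hδ'
  have hmid := h₀.tendsto_setIntegral_abs_deriv h hc hf hF (half_pos hδ0)
  filter_upwards [hc.eventually (gt_mem_nhds (show (0 : ℝ) < δ / 4 by positivity)),
    hpp.eventually (gt_mem_nhds he0), hmid.eventually (gt_mem_nhds (lt_add_of_pos_right _ he0))]
    with j hcj hpj hmj
  -- The two gaps differ by at most `δ / 2`, so `F j - f j ≤ δ` forces `F₀ - f₀ ≤ 2δ = δ'`, and `F j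
  -- - f j > δ` forces `F₀ - f₀ > δ / 2`.
  have hw : ∀ x, |(F j x - f j x) - (F₀ x - f₀ x)| ≤ δ / 2 := fun x => by
    have h1 := abs_sub (F j x - F₀ x) (f j x - f₀ x)
    have h2 : (F j x - f j x) - (F₀ x - f₀ x) = (F j x - F₀ x) - (f j x - f₀ x) := by ring
    rw [h2]
    linarith [hf j x, hF j x]
  have hFi : Integrable (fun x => |deriv (F j) x|) volume := (h j).integrable_deriv.abs
  have hF₀i : Integrable (fun x => |deriv F₀ x|) volume := h₀.integrable_deriv.abs
  have hsplit : ∫ x, |deriv (F j) x| = (∫ x in {x | F j x - f j x ≤ δ}, |deriv (F j) x|) +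
      ∫ x in {x | F j x - f j x ≤ δ}ᶜ, |deriv (F j) x| :=
    (integral_add_compl ((h j).measurableSet_le δ) hFi).symm
  have hA : ∫ x in {x | F j x - f j x ≤ δ}, |deriv (F j) x| ≤
      e + ((∫ x in {x | F₀ x - f₀ x ≤ 0}, p₀ x) + e) := by
    calc ∫ x in {x | F j x - f j x ≤ δ}, |deriv (F j) x|
        ≤ ∫ x in {x | F j x - f j x ≤ δ}, |deriv (f j) x| :=
          (h j).setIntegral_abs_deriv_le_of_le hδ0
      _ ≤ ∫ x in {x | F j x - f j x ≤ δ}, (|p j x - p₀ x| + p₀ x) := by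
          refine setIntegral_mono_ae (h j).hasPrim.integrable.abs.integrableOn
            (((hp j).sub hp₀).abs.add hp₀).integrableOn ?_
          filter_upwards [hfp j] with x hx
          have := le_abs_self (p j x - p₀ x)
          linarith
      _ = (∫ x in {x | F j x - f j x ≤ δ}, |p j x - p₀ x|) +
            ∫ x in {x | F j x - f j x ≤ δ}, p₀ x :=
          integral_add ((hp j).sub hp₀).abs.integrableOn hp₀.integrableOn
      _ ≤ e + ∫ x in {x | F₀ x - f₀ x ≤ δ'}, p₀ x := by
          refine add_le_add ((setIntegral_le_integral ((hp j).sub hp₀).abs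
            (ae_of_all _ fun x => abs_nonneg _)).trans hpj.le) ?_
          refine setIntegral_mono_set hp₀.integrableOn ?_ ?_
          · filter_upwards [ae_restrict_of_ae hfp₀] with x hx
            rw [hx]; exact abs_nonneg _
          · refine LE.le.eventuallyLE fun x (hx : F j x - f j x ≤ δ) => ?_
            have := (abs_le.1 (hw x)).1
            show F₀ x - f₀ x ≤ δ'
            linarith
      _ ≤ e + ((∫ x in {x | F₀ x - f₀ x ≤ 0}, p₀ x) + e) := by linarith
  have hC : ∫ x in {x | F₀ x - f₀ x ≤ 0}, p₀ x = ∫ x in {x | F₀ x - f₀ x ≤ 0}, |deriv F₀ x| := by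
    refine setIntegral_congr_ae (h₀.measurableSet_le 0) ?_
    filter_upwards [hfp₀, h₀.ae_deriv_eq_of_le_zero] with x hx hx' hx0
    rw [hx, hx' hx0]
  have hD : ∫ x in {x | F j x - f j x ≤ δ}ᶜ, |deriv (F j) x| <
      (∫ x in {x | F₀ x - f₀ x ≤ 0}ᶜ, |deriv F₀ x|) + e := by
    calc ∫ x in {x | F j x - f j x ≤ δ}ᶜ, |deriv (F j) x|
        ≤ ∫ x in {x | δ / 2 < F₀ x - f₀ x}, |deriv (F j) x| := by
          refine setIntegral_mono_set hFi.integrableOn (ae_of_all _ fun x => abs_nonneg _)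
            (LE.le.eventuallyLE fun x (hx : ¬ F j x - f j x ≤ δ) => ?_)
          have := (abs_le.1 (hw x)).2
          show δ / 2 < F₀ x - f₀ x
          linarith [not_le.1 hx]
      _ < (∫ x in {x | δ / 2 < F₀ x - f₀ x}, |deriv F₀ x|) + e := hmj
      _ ≤ (∫ x in {x | F₀ x - f₀ x ≤ 0}ᶜ, |deriv F₀ x|) + e := by
          refine add_le_add ?_ le_rfl
          refine setIntegral_mono_set hF₀i.integrableOn (ae_of_all _ fun x => abs_nonneg _)
            (LE.le.eventuallyLE fun x (hx : δ / 2 < F₀ x - f₀ x) => ?_)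
          show ¬ F₀ x - f₀ x ≤ 0
          linarith
  have htot := integral_add_compl (h₀.measurableSet_le 0) hF₀i
  have hb' : b = (∫ x, |deriv F₀ x|) + 3 * e := by rw [he]; ring
  rw [hsplit, hb', ← htot, ← hC]
  linarith

end Convergence
-- Convexity from touching functions
-- A positive second derivative at a critical point would make it a local minimum as well, hence `h`
-- locally constant, and its second derivative zero.
lemma nonpos_of_isLocalMax {h h1 : ℝ → ℝ} {h2 x : ℝ} (hd : ∀ᶠ y in 𝓝 x, HasDerivAt h (h1 y) y)
    (hd2 : HasDerivAt h1 h2 x) (hmax : IsLocalMax h x) : h2 ≤ 0 := by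
  by_contra! hpos
  have hderiv : deriv h =ᶠ[𝓝 x] h1 := hd.mono fun y hy => hy.deriv
  have h3 : deriv (deriv h) x = h2 := by rw [hderiv.deriv_eq, hd2.deriv]
  have hmin : IsLocalMin h x := isLocalMin_of_deriv_deriv_pos (by rw [h3]; exact hpos)
    hmax.deriv_eq_zero hd.self_of_nhds.continuousAt
  have hconst : h =ᶠ[𝓝 x] fun _ => h x := by
    filter_upwards [hmax, hmin] with y hy1 hy2 using le_antisymm hy1 hy2
  have h4 : deriv (deriv h) x = 0 := by
    rw [(hconst.deriv).deriv_eq]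
    simp
  linarith

/-- A continuous function that at every point of an interval is touched from below by a function
with nonnegative second derivative is convex. -/
lemma convexOn_of_touching {F : ℝ → ℝ} {a b : ℝ} (hF : Continuous F)
    (H : ∀ x ∈ Set.Icc a b, ∃ u u1 : ℝ → ℝ, ∃ u2 : ℝ, (∀ y, u y ≤ F y) ∧ u x = F x ∧
      (∀ y, HasDerivAt u (u1 y) y) ∧ HasDerivAt u1 u2 x ∧ 0 ≤ u2) :
    ConvexOn ℝ (Set.Icc a b) F := by
  have key : ∀ x ∈ Set.Icc a b, ∀ y ∈ Set.Icc a b, x < y → ∀ z ∈ Set.Icc x y,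
      F z ≤ F x + (F y - F x) / (y - x) * (z - x) := by
    intro x hx y hy hxy z hz
    by_contra! hlt
    set k := (F y - F x) / (y - x) with hk
    have hky : k * (y - x) = F y - F x := div_mul_cancel₀ _ (by linarith)
    set e := F z - (F x + k * (z - x)) with he
    have he0 : 0 < e := by rw [he]; linarith
    have hz0 : 0 ≤ (z - x) * (y - z) := mul_nonneg (by linarith [hz.1]) (by linarith [hz.2])
    -- The chord is bent into a strictly concave parabola `Q` with the same endpoints, and `κ` is
    -- small enough that `F` still exceeds `Q` at `z`. So `F - Q` has a positive interior maximum,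
    -- where the touching function would have second derivative at most `-2κ`.
    set κ := e / (2 * ((z - x) * (y - z) + 1)) with hκ
    have hκ0 : 0 < κ := by positivity
    have hκz : κ * ((z - x) * (y - z)) < e := by
      rw [hκ, div_mul_eq_mul_div, div_lt_iff₀ (by positivity)]
      nlinarith
    set Q : ℝ → ℝ := fun s => F x + k * (s - x) + κ * ((s - x) * (y - s)) with hQ
    obtain ⟨x₀, hx₀, hmax⟩ := isCompact_Icc.exists_isMaxOn (Set.nonempty_Icc.2 hxy.le)
      (f := fun s => F s - Q s) (by fun_prop)
    have hval : 0 < F x₀ - Q x₀ := by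
      refine lt_of_lt_of_le ?_ (hmax hz)
      simp only [hQ]
      linarith
    have hne1 : x ≠ x₀ := by
      rintro rfl
      simp [hQ] at hval
    have hne2 : x₀ ≠ y := by
      rintro rfl
      simp only [hQ, hky] at hval
      simp at hval
    have hlt1 : x < x₀ := lt_of_le_of_ne hx₀.1 hne1
    have hlt2 : x₀ < y := lt_of_le_of_ne hx₀.2 hne2
    obtain ⟨u, u1, u2, hule, hux, hu1, hu2, hu0⟩ :=
      H x₀ ⟨hx.1.trans hlt1.le, hlt2.le.trans hy.2⟩
    have hQ1 : ∀ s, HasDerivAt Q (k + κ * ((y - s) - (s - x))) s := by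
      intro s
      have h1 : HasDerivAt (fun s => s - x) 1 s := (hasDerivAt_id s).sub_const x
      have h2 : HasDerivAt (fun s => y - s) (-1) s := (hasDerivAt_id s).const_sub y
      have h3 := ((h1.const_mul k).const_add (F x)).add ((h1.mul h2).const_mul κ)
      refine h3.congr_deriv ?_
      ring
    have hQ2 : HasDerivAt (fun s => k + κ * ((y - s) - (s - x))) (-2 * κ) x₀ := by
      have h1 : HasDerivAt (fun s => s - x) 1 x₀ := (hasDerivAt_id x₀).sub_const x
      have h2 : HasDerivAt (fun s => y - s) (-1) x₀ := (hasDerivAt_id x₀).const_sub y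
      refine (((h2.sub h1).const_mul κ).const_add k).congr_deriv ?_
      ring
    have hlm : IsLocalMax (fun s => u s - Q s) x₀ := by
      filter_upwards [Icc_mem_nhds hlt1 hlt2] with s hs
      have h1 : F s - Q s ≤ F x₀ - Q x₀ := hmax hs
      rw [hux]
      linarith [hule s]
    have := nonpos_of_isLocalMax (Eventually.of_forall fun s => (hu1 s).sub (hQ1 s))
      (hu2.sub hQ2) hlm
    linarith
  refine LinearOrder.convexOn_of_lt (convex_Icc a b) fun x hx y hy hxy α β hα hβ hαβ => ?_
  have h1 := key x hx y hy hxy (α • x + β • y) ⟨?_, ?_⟩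
  · refine h1.trans (le_of_eq ?_)
    have h2 : α • x + β • y - x = β * (y - x) := by
      simp only [smul_eq_mul]
      rw [← eq_sub_iff_add_eq] at hαβ
      rw [hαβ]; ring
    have h3 : (F y - F x) / (y - x) * (y - x) = F y - F x := div_mul_cancel₀ _ (by linarith)
    rw [h2, show (F y - F x) / (y - x) * (β * (y - x)) = β * ((F y - F x) / (y - x) * (y - x)) by
      ring, h3]
    simp only [smul_eq_mul]
    rw [← eq_sub_iff_add_eq] at hαβ
    rw [hαβ]; ring
  · simp only [smul_eq_mul]
    obtain rfl : α = 1 - β := by linarith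
    nlinarith [mul_pos hβ (sub_pos.2 hxy)]
  · simp only [smul_eq_mul]
    obtain rfl : β = 1 - α := by linarith
    nlinarith [mul_pos hα (sub_pos.2 hxy)]

/-! ### Derivatives of scaled convolutions in space and scale -/

/-- The convolution of `f` with the scaled profile `t⁻ᵏ g(·/t)`. -/
noncomputable def scaledConv (f g : ℝ → ℝ) (k : ℕ) (x t : ℝ) : ℝ :=
  ∫ y, f y * (t⁻¹ ^ k * g ((x - y) / t))

section ScaledConv

variable {f g g' : ℝ → ℝ} {C : ℝ}

lemma integrable_scaledConv (hf : Integrable f volume) (hg : Measurable g) (hC : ∀ z, |g z| ≤ C)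
    (k : ℕ) (x t : ℝ) : Integrable (fun y => f y * (t⁻¹ ^ k * g ((x - y) / t))) volume := by
  refine hf.mul_bdd (c := |t⁻¹ ^ k| * C) ?_ (ae_of_all _ fun y => ?_)
  · exact (Measurable.const_mul (hg.comp (by fun_prop)) _).aestronglyMeasurable
  · rw [norm_mul]
    exact mul_le_mul_of_nonneg_left (hC _) (norm_nonneg _)

lemma hasDerivAt_scaledConv_left (hf : Integrable f volume) (hg : ∀ z, HasDerivAt g (g' z) z)
    (hC : ∀ z, |g z| ≤ C) (hC' : ∀ z, |g' z| ≤ C) (k : ℕ) {x t : ℝ} (ht : 0 < t) :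
    HasDerivAt (fun x => scaledConv f g k x t) (scaledConv f g' (k + 1) x t) x := by
  have hgm : Measurable g := (continuous_iff_continuousAt.2 fun z => (hg z).continuousAt).measurable
  have hg'm : Measurable g' := by
    rw [show g' = deriv g from funext fun z => (hg z).deriv.symm]
    exact measurable_deriv g
  refine (hasDerivAt_integral_of_dominated_loc_of_deriv_le (s := Set.univ)
    (bound := fun y => |f y| * (t⁻¹ ^ (k + 1) * C))
    (F' := fun x y => f y * (t⁻¹ ^ (k + 1) * g' ((x - y) / t))) univ_mem
    (Eventually.of_forall fun x => (integrable_scaledConv hf hgm hC k x t).aestronglyMeasurable)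
    (integrable_scaledConv hf hgm hC k x t)
    (integrable_scaledConv hf hg'm hC' (k + 1) x t).aestronglyMeasurable
    (ae_of_all _ fun y z _ => ?_) (hf.abs.mul_const _) (ae_of_all _ fun y z _ => ?_)).2
  · rw [norm_mul, norm_mul, Real.norm_of_nonneg (by positivity : 0 ≤ t⁻¹ ^ (k + 1))]
    exact mul_le_mul_of_nonneg_left (mul_le_mul_of_nonneg_left (hC' _) (by positivity))
      (abs_nonneg _)
  · have h1 : HasDerivAt (fun x => (x - y) / t) (1 / t) z :=
      ((hasDerivAt_id z).sub_const y).div_const t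
    have h2 := (((hg ((z - y) / t)).comp z h1).const_mul (t⁻¹ ^ k)).const_mul (f y)
    refine h2.congr_deriv ?_
    rw [pow_succ]; ring

/-- The family is closed under differentiation: with `z = (x-y)/t`, the scale derivative of `t⁻ᵏ
g(z)` is `-t^{-(k+1)} (k g(z) + z g'(z))`. Restricting to scales above `t / 2` gives the dominating
function. -/
lemma hasDerivAt_scaledConv_right (hf : Integrable f volume) (hg : ∀ z, HasDerivAt g (g' z) z)
    (hC : ∀ z, |g z| ≤ C) (hC' : ∀ z, |z * g' z| ≤ C) (k : ℕ) {x t : ℝ} (ht : 0 < t) :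
    HasDerivAt (fun t => scaledConv f g k x t)
      (-scaledConv f (fun z => k * g z + z * g' z) (k + 1) x t) t := by
  have hgm : Measurable g := (continuous_iff_continuousAt.2 fun z => (hg z).continuousAt).measurable
  have hg'm : Measurable g' := by
    rw [show g' = deriv g from funext fun z => (hg z).deriv.symm]
    exact measurable_deriv g
  have hψm : Measurable fun z => (k : ℝ) * g z + z * g' z :=
    (hgm.const_mul _).add (measurable_id.mul hg'm)
  have hψ : ∀ z, |(k : ℝ) * g z + z * g' z| ≤ k * C + C := fun z => by
    refine (abs_add_le _ _).trans (add_le_add ?_ (hC' z))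
    rw [abs_mul, Nat.abs_cast]
    exact mul_le_mul_of_nonneg_left (hC z) (Nat.cast_nonneg k)
  have hC0 : 0 ≤ C := (abs_nonneg _).trans (hC 0)
  have hmain := (hasDerivAt_integral_of_dominated_loc_of_deriv_le (s := Set.Ioi (t / 2))
    (bound := fun y => |f y| * ((t / 2)⁻¹ ^ (k + 1) * (k * C + C))) (μ := volume)
    (F := fun t y => f y * (t⁻¹ ^ k * g ((x - y) / t))) (x₀ := t)
    (F' := fun t y => -(f y * (t⁻¹ ^ (k + 1) * (k * g ((x - y) / t) +
      (x - y) / t * g' ((x - y) / t))))) (Ioi_mem_nhds (by linarith))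
    (Eventually.of_forall fun t => (integrable_scaledConv hf hgm hC k x t).aestronglyMeasurable)
    (integrable_scaledConv hf hgm hC k x t)
    (integrable_scaledConv hf hψm hψ (k + 1) x t).aestronglyMeasurable.neg
    (ae_of_all _ fun y s hs => ?_) (hf.abs.mul_const _) (ae_of_all _ fun y s hs => ?_)).2
  · rw [integral_neg] at hmain
    exact hmain
  · have hs' : t / 2 < s := hs
    have hs0 : 0 < s := by linarith
    rw [norm_neg, norm_mul, norm_mul, Real.norm_of_nonneg (by positivity : 0 ≤ s⁻¹ ^ (k + 1))]
    refine mul_le_mul_of_nonneg_left (mul_le_mul ?_ (hψ _) (abs_nonneg _) (by positivity))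
      (abs_nonneg _)
    exact pow_le_pow_left₀ (by positivity) (inv_anti₀ (by linarith) hs'.le) _
  · have hs' : t / 2 < s := hs
    have hs0 : s ≠ 0 := by linarith
    have h0 : HasDerivAt (fun s : ℝ => s⁻¹) (-(s ^ 2)⁻¹) s := hasDerivAt_inv hs0
    have h1 : HasDerivAt (fun s => (x - y) / s) ((x - y) * (-(s ^ 2)⁻¹)) s := by
      simpa only [div_eq_mul_inv] using h0.const_mul (x - y)
    have h2 := ((h0.pow k).mul ((hg ((x - y) / s)).comp s h1)).const_mul (f y)
    refine h2.congr_deriv ?_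
    simp only [Pi.pow_apply, Function.comp_apply]
    -- The power rule produces the natural-number exponent `k - 1`, so `k = 0` is separate.
    rcases k with _ | k
    · simp only [pow_zero, Nat.cast_zero, div_eq_mul_inv, ← inv_pow]
      ring
    · simp only [Nat.add_sub_cancel, Nat.cast_add, Nat.cast_one, div_eq_mul_inv, ← inv_pow]
      ring

end ScaledConv

/-! ### Admissible kernels and the differential equation -/

/-- A kernel of integral one whose dilations solve `a u_tt - b u_t / t + u_xx = 0` in the upper half
plane, with `a ≥ 0`. -/
structure IsAdmissible (φ φ' φ'' : ℝ → ℝ) (a b C : ℝ) : Prop where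
  nonneg : ∀ z, 0 ≤ φ z
  integrable : Integrable φ volume
  integral_eq_one : ∫ z, φ z = 1
  hasDerivAt : ∀ z, HasDerivAt φ (φ' z) z
  hasDerivAt' : ∀ z, HasDerivAt φ' (φ'' z) z
  bound : ∀ z, |φ z| ≤ C
  bound' : ∀ z, |φ' z| ≤ C
  bound_mul' : ∀ z, |z * φ' z| ≤ C
  bound'' : ∀ z, |φ'' z| ≤ C
  bound_sq_mul'' : ∀ z, |z ^ 2 * φ'' z| ≤ C
  a_nonneg : 0 ≤ a
  ode : ∀ z, φ'' z = b * (φ z + z * φ' z) - a * (2 * φ z + 4 * (z * φ' z) + z ^ 2 * φ'' z)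

namespace IsAdmissible

variable {φ φ' φ'' : ℝ → ℝ} {a b C : ℝ}

lemma continuous (h : IsAdmissible φ φ' φ'' a b C) : Continuous φ :=
  continuous_iff_continuousAt.2 fun z => (h.hasDerivAt z).continuousAt

/-- At a maximum in the scale variable the extension has nonnegative second space derivative. -/
lemma exists_touching (h : IsAdmissible φ φ' φ'' a b C) {f : ℝ → ℝ} (hf : Integrable f volume)
    {x t : ℝ} (ht : 0 < t) (hmax : ∀ s, 0 < s → scaledConv f φ 1 x s ≤ scaledConv f φ 1 x t) :
    ∃ u1 : ℝ → ℝ, ∃ u2 : ℝ, (∀ y, HasDerivAt (fun x => scaledConv f φ 1 x t) (u1 y) y) ∧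
      HasDerivAt u1 u2 x ∧ 0 ≤ u2 := by
  have hC0 : 0 ≤ C := (abs_nonneg _).trans (h.bound 0)
  refine ⟨fun y => scaledConv f φ' 2 y t, scaledConv f φ'' 3 x t, fun y =>
    hasDerivAt_scaledConv_left hf h.hasDerivAt h.bound h.bound' 1 ht,
    hasDerivAt_scaledConv_left hf h.hasDerivAt' h.bound' h.bound'' 2 ht, ?_⟩
  set ψ : ℝ → ℝ := fun z => φ z + z * φ' z with hψ
  set ψ' : ℝ → ℝ := fun z => 2 * φ' z + z * φ'' z with hψ'
  have hψd : ∀ z, HasDerivAt ψ (ψ' z) z := fun z => by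
    refine ((h.hasDerivAt z).add ((hasDerivAt_id z).mul (h.hasDerivAt' z))).congr_deriv ?_
    simp only [hψ', id]
    ring
  have hψb : ∀ z, |ψ z| ≤ 3 * C := fun z => by
    have := abs_add_le (φ z) (z * φ' z)
    have h1 := h.bound z
    have h2 := h.bound_mul' z
    simp only [hψ]
    linarith
  have hψ'b : ∀ z, |z * ψ' z| ≤ 3 * C := fun z => by
    have h3 : z * ψ' z = 2 * (z * φ' z) + z ^ 2 * φ'' z := by simp only [hψ']; ring
    rw [h3]
    have := abs_add_le (2 * (z * φ' z)) (z ^ 2 * φ'' z)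
    rw [abs_mul, abs_two] at this
    have h1 := h.bound_mul' z
    have h2 := h.bound_sq_mul'' z
    linarith
  have hd1 : ∀ s, 0 < s → HasDerivAt (fun s => scaledConv f φ 1 x s) (-scaledConv f ψ 2 x s) s := by
    intro s hs
    have h1 := hasDerivAt_scaledConv_right (x := x) hf h.hasDerivAt h.bound h.bound_mul' 1 hs
    simpa only [Nat.cast_one, one_mul] using h1
  have hd2 : HasDerivAt (fun s => -scaledConv f ψ 2 x s)
      (scaledConv f (fun z => 2 * ψ z + z * ψ' z) 3 x t) t := by
    have h1 := (hasDerivAt_scaledConv_right (x := x) hf hψd hψb hψ'b 2 ht).neg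
    exact h1.congr_deriv (by simp only [Nat.cast_ofNat, neg_neg])
  have hlm : IsLocalMax (fun s => scaledConv f φ 1 x s) t := by
    filter_upwards [Ioi_mem_nhds ht] with s hs using hmax s hs
  have h0 : -scaledConv f ψ 2 x t = 0 := hlm.hasDerivAt_eq_zero (hd1 t ht)
  have h2 := nonpos_of_isLocalMax (eventually_of_mem (Ioi_mem_nhds ht) hd1) hd2 hlm
  have hψm : Measurable ψ :=
    (continuous_iff_continuousAt.2 fun z => (hψd z).continuousAt).measurable
  have hψ'm : Measurable ψ' := by
    rw [show ψ' = deriv ψ from funext fun z => (hψd z).deriv.symm]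
    exact measurable_deriv ψ
  have hχm : Measurable fun z => 2 * ψ z + z * ψ' z :=
    (hψm.const_mul _).add (measurable_id.mul hψ'm)
  have hχb : ∀ z, |2 * ψ z + z * ψ' z| ≤ 9 * C := fun z => by
    have := abs_add_le (2 * ψ z) (z * ψ' z)
    rw [abs_mul, abs_two] at this
    linarith [hψb z, hψ'b z]
  have hkey : scaledConv f φ'' 3 x t = b * (t⁻¹ * scaledConv f ψ 2 x t) -
      a * scaledConv f (fun z => 2 * ψ z + z * ψ' z) 3 x t := by
    simp only [scaledConv]
    rw [← integral_const_mul, ← integral_const_mul, ← integral_const_mul, ← integral_sub]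
    · refine integral_congr_ae (ae_of_all _ fun y => ?_)
      simp only
      rw [h.ode ((x - y) / t)]
      simp only [hψ, hψ']
      ring
    · exact ((integrable_scaledConv hf hψm hψb 2 x t).const_mul _).const_mul _
    · exact (integrable_scaledConv hf hχm hχb 3 x t).const_mul _
  -- The first-order term drops out at the maximal scale, leaving `U_xx = -a U_tt` with `a ≥ 0` and
  -- `U_tt ≤ 0`.
  rw [hkey, neg_eq_zero.1 h0]
  nlinarith [h.a_nonneg]

end IsAdmissible
-- The maximal function of a nonnegative function is detached from it
/-- The average of `f` around `x` at scale `t` weighted by `φ`. -/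
noncomputable def avg (φ f : ℝ → ℝ) (x t : ℝ) : ℝ := ∫ z, f (x - t * z) * φ z

/-- The maximal function in terms of averages. -/
noncomputable def maxAvg (φ f : ℝ → ℝ) (x : ℝ) : ℝ := ⨆ t : Set.Ioi (0 : ℝ), avg φ f x t

/-- Substitution `y = x - t z`. Derivatives are taken in the convolution form, while the averaged
form extends continuously to `t = 0`, where its value is `f x`. -/
lemma scaledConv_one_eq_avg (φ f : ℝ → ℝ) (x : ℝ) {t : ℝ} (ht : 0 < t) :
    scaledConv f φ 1 x t = avg φ f x t := by
  have h1 : avg φ f x t = ∫ z, (fun s => f (x - s) * φ (s / t)) (t * z) := by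
    refine integral_congr_ae (ae_of_all _ fun z => ?_)
    simp only
    rw [mul_div_cancel_left₀ _ ht.ne']
  rw [h1, Measure.integral_comp_mul_left (fun s => f (x - s) * φ (s / t)) t, abs_of_pos (inv_pos.2 ht),
    ← integral_sub_left_eq_self (fun s => f (x - s) * φ (s / t)) volume x, smul_eq_mul,
    ← integral_const_mul]
  refine integral_congr_ae (ae_of_all _ fun y => ?_)
  simp only [sub_sub_cancel, pow_one]
  ring

namespace IsAdmissible

variable {φ φ' φ'' : ℝ → ℝ} {a b C : ℝ} {f f₁ f₂ : ℝ → ℝ} {B : ℝ}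

lemma integrable_avg (h : IsAdmissible φ φ' φ'' a b C) (hf : Continuous f) (hB : ∀ x, |f x| ≤ B)
    (x t : ℝ) : Integrable (fun z => f (x - t * z) * φ z) volume :=
  h.integrable.bdd_mul (c := B) (Continuous.aestronglyMeasurable (by fun_prop))
    (ae_of_all _ fun z => hB _)

lemma continuous_avg (h : IsAdmissible φ φ' φ'' a b C) (hf : Continuous f) (hB : ∀ x, |f x| ≤ B)
    (x : ℝ) : Continuous (avg φ f x) := by
  refine continuous_of_dominated (bound := fun z => B * |φ z|)
    (fun t => (h.integrable_avg hf hB x t).aestronglyMeasurable)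
    (fun t => ae_of_all _ fun z => ?_) (h.integrable.abs.const_mul B) (ae_of_all _ fun z => ?_)
  · rw [norm_mul]
    exact mul_le_mul_of_nonneg_right (hB _) (norm_nonneg _)
  · fun_prop

lemma avg_zero (h : IsAdmissible φ φ' φ'' a b C) (x : ℝ) : avg φ f x 0 = f x := by
  simp only [avg, zero_mul, sub_zero]
  rw [integral_const_mul, h.integral_eq_one, mul_one]

lemma abs_avg_sub_avg_le (h : IsAdmissible φ φ' φ'' a b C) (hf₁ : Continuous f₁)
    (hB₁ : ∀ x, |f₁ x| ≤ B) (hf₂ : Continuous f₂) (hB₂ : ∀ x, |f₂ x| ≤ B) {c x y : ℝ}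
    (hc : ∀ z, |f₁ (x - z) - f₂ (y - z)| ≤ c) (t : ℝ) :
    |avg φ f₁ x t - avg φ f₂ y t| ≤ c := by
  simp only [avg]
  rw [← integral_sub (h.integrable_avg hf₁ hB₁ x t) (h.integrable_avg hf₂ hB₂ y t)]
  have h1 : ‖∫ z, (f₁ (x - t * z) * φ z - f₂ (y - t * z) * φ z)‖ ≤ ∫ z, c * φ z := by
    refine norm_integral_le_of_norm_le (h.integrable.const_mul c) (ae_of_all _ fun z => ?_)
    rw [← sub_mul, norm_mul, Real.norm_of_nonneg (h.nonneg z)]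
    exact mul_le_mul_of_nonneg_right (hc _) (h.nonneg z)
  rwa [integral_const_mul, h.integral_eq_one, mul_one] at h1

lemma abs_avg_le (h : IsAdmissible φ φ' φ'' a b C) (hf : Continuous f) (hB : ∀ x, |f x| ≤ B)
    (x t : ℝ) : |avg φ f x t| ≤ B := by
  have h0 : 0 ≤ B := (abs_nonneg _).trans (hB 0)
  have h1 := h.abs_avg_sub_avg_le hf hB (continuous_const (y := (0 : ℝ))) (by simpa using h0)
    (x := x) (y := x) (c := B) (by simpa using fun z => hB (x - z)) t
  simpa [avg] using h1

lemma bddAbove_avg (h : IsAdmissible φ φ' φ'' a b C) (hf : Continuous f) (hB : ∀ x, |f x| ≤ B)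
    (x : ℝ) : BddAbove (Set.range fun t : Set.Ioi (0 : ℝ) => avg φ f x t) :=
  ⟨B, Set.forall_mem_range.2 fun t => (le_abs_self _).trans (h.abs_avg_le hf hB x t)⟩

lemma avg_le_maxAvg (h : IsAdmissible φ φ' φ'' a b C) (hf : Continuous f) (hB : ∀ x, |f x| ≤ B)
    (x : ℝ) {t : ℝ} (ht : 0 < t) : avg φ f x t ≤ maxAvg φ f x :=
  le_ciSup (h.bddAbove_avg hf hB x) (⟨t, ht⟩ : Set.Ioi (0 : ℝ))

lemma maxAvg_le {c x : ℝ} (hc : ∀ t, 0 < t → avg φ f x t ≤ c) : maxAvg φ f x ≤ c :=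
  ciSup_le fun t => hc t t.2

/-- Allowing two functions and two base points gives at once the contraction property in the
supremum norm (`x = y`) and the modulus of continuity of the maximal function (`f₁ = f₂`). -/
lemma abs_maxAvg_sub_le (h : IsAdmissible φ φ' φ'' a b C) (hf₁ : Continuous f₁)
    (hB₁ : ∀ x, |f₁ x| ≤ B) (hf₂ : Continuous f₂) (hB₂ : ∀ x, |f₂ x| ≤ B) {c x y : ℝ}
    (hc : ∀ z, |f₁ (x - z) - f₂ (y - z)| ≤ c) : |maxAvg φ f₁ x - maxAvg φ f₂ y| ≤ c := by
  rw [abs_le]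
  have key := h.abs_avg_sub_avg_le hf₁ hB₁ hf₂ hB₂ hc
  constructor
  · have : maxAvg φ f₂ y ≤ maxAvg φ f₁ x + c := maxAvg_le fun t ht => by
      linarith [h.avg_le_maxAvg hf₁ hB₁ x ht, (abs_le.1 (key t)).1]
    linarith
  · have : maxAvg φ f₁ x ≤ maxAvg φ f₂ y + c := maxAvg_le fun t ht => by
      linarith [h.avg_le_maxAvg hf₂ hB₂ y ht, (abs_le.1 (key t)).2]
    linarith

lemma le_maxAvg (h : IsAdmissible φ φ' φ'' a b C) (hf : Continuous f) (hB : ∀ x, |f x| ≤ B)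
    (x : ℝ) : f x ≤ maxAvg φ f x := by
  have h1 : Tendsto (avg φ f x) (𝓝[>] 0) (𝓝 (f x)) := by
    have := ((h.continuous_avg hf hB x).tendsto 0).mono_left
      (nhdsWithin_le_nhds (s := Set.Ioi (0 : ℝ)))
    rwa [h.avg_zero] at this
  exact le_of_tendsto h1 (eventually_mem_nhdsWithin.mono fun t ht => h.avg_le_maxAvg hf hB x ht)

lemma avg_le_div (h : IsAdmissible φ φ' φ'' a b C) (hfi : Integrable f volume)
    (hf0 : ∀ x, 0 ≤ f x) (x : ℝ) {t : ℝ} (ht : 0 < t) :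
    avg φ f x t ≤ C * (∫ y, f y) / t := by
  rw [← scaledConv_one_eq_avg φ f x ht, scaledConv]
  calc ∫ y, f y * (t⁻¹ ^ 1 * φ ((x - y) / t)) ≤ ∫ y, (C / t) * f y := by
        refine integral_mono (integrable_scaledConv hfi h.continuous.measurable h.bound 1 x t)
          (hfi.const_mul _) fun y => ?_
        have h1 : φ ((x - y) / t) ≤ C := (le_abs_self _).trans (h.bound _)
        have h2 : t⁻¹ * φ ((x - y) / t) ≤ t⁻¹ * C :=
          mul_le_mul_of_nonneg_left h1 (inv_nonneg.2 ht.le)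
        simp only [pow_one]
        refine (mul_le_mul_of_nonneg_left h2 (hf0 y)).trans (le_of_eq ?_)
        ring
    _ = C * (∫ y, f y) / t := by rw [integral_const_mul]; ring

lemma exists_avg_lt (h : IsAdmissible φ φ' φ'' a b C) (hfi : Integrable f volume)
    (hf0 : ∀ x, 0 ≤ f x) {m : ℝ} (hm : 0 < m) :
    ∃ T, 0 < T ∧ ∀ x t, T ≤ t → avg φ f x t < m := by
  have hC0 : 0 ≤ C := (abs_nonneg _).trans (h.bound 0)
  have hI : 0 ≤ ∫ y, f y := integral_nonneg hf0
  refine ⟨(C * (∫ y, f y) + 1) / m, by positivity, fun x t ht => ?_⟩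
  have ht0 : 0 < t := lt_of_lt_of_le (by positivity) ht
  refine (h.avg_le_div hfi hf0 x ht0).trans_lt ?_
  rw [div_le_iff₀ hm] at ht
  rw [div_lt_iff₀ ht0]
  linarith

/-- Averages at large scales are `O(1/t)`, hence below a level strictly between `f x` and the
supremum. So the supremum is a maximum over a compact interval `[0, T']`, and `t = 0` is excluded
because the value there is `f x`. -/
lemma exists_avg_eq_maxAvg (h : IsAdmissible φ φ' φ'' a b C) (hf : Continuous f)
    (hB : ∀ x, |f x| ≤ B) (hfi : Integrable f volume) (hf0 : ∀ x, 0 ≤ f x) {x : ℝ}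
    (hx : f x < maxAvg φ f x) : ∃ t, 0 < t ∧ avg φ f x t = maxAvg φ f x := by
  obtain ⟨m, hm1, hm2⟩ := exists_between hx
  obtain ⟨T', hT', hlt'⟩ := h.exists_avg_lt hfi hf0 (m := m) ((hf0 x).trans_lt hm1)
  obtain ⟨t, ht, hmax⟩ := isCompact_Icc.exists_isMaxOn (Set.nonempty_Icc.2 hT'.le)
    (h.continuous_avg hf hB x).continuousOn
  have hle : maxAvg φ f x ≤ max m (avg φ f x t) := maxAvg_le fun s hs => by
    rcases le_or_gt T' s with hs' | hs'
    · exact (hlt' x s hs').le.trans (le_max_left _ _)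
    · exact (hmax ⟨hs.le, hs'.le⟩).trans (le_max_right _ _)
  have hle' : maxAvg φ f x ≤ avg φ f x t := (le_max_iff.1 hle).resolve_left (not_le.2 hm2)
  have ht0 : 0 < t := by
    rcases ht.1.eq_or_lt with h0 | h0
    · rw [← h0, h.avg_zero] at hle'
      exact absurd hx (not_lt.2 hle')
    · exact h0
  exact ⟨t, ht0, le_antisymm (h.avg_le_maxAvg hf hB x ht0) hle'⟩

lemma convexOn_maxAvg (h : IsAdmissible φ φ' φ'' a b C) (hf : Continuous f)
    (hB : ∀ x, |f x| ≤ B) (hfi : Integrable f volume) (hf0 : ∀ x, 0 ≤ f x)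
    (hcont : Continuous (maxAvg φ f)) (x₁ x₂ : ℝ)
    (hx : ∀ x ∈ Set.Icc x₁ x₂, f x < maxAvg φ f x) :
    ConvexOn ℝ (Set.Icc x₁ x₂) (maxAvg φ f) := by
  refine convexOn_of_touching hcont fun x hxI => ?_
  obtain ⟨t, ht, hteq⟩ := h.exists_avg_eq_maxAvg hf hB hfi hf0 (hx x hxI)
  obtain ⟨u1, u2, h1, h2, h3⟩ := h.exists_touching hfi (x := x) ht fun s hs => by
    rw [scaledConv_one_eq_avg φ f x hs, scaledConv_one_eq_avg φ f x ht, hteq]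
    exact h.avg_le_maxAvg hf hB x hs
  refine ⟨fun y => scaledConv f φ 1 y t, u1, u2, fun y => ?_, ?_, h1, h2, h3⟩
  · simp only
    rw [scaledConv_one_eq_avg φ f y ht]
    exact h.avg_le_maxAvg hf hB y ht
  · simp only
    rw [scaledConv_one_eq_avg φ f x ht, hteq]

lemma exists_setIntegral_lt (h : IsAdmissible φ φ' φ'' a b C) {e : ℝ} (he : 0 < e) :
    ∃ Z : ℝ, 0 ≤ Z ∧ ∫ z in {z | Z < |z|}, φ z < e := by
  have hlim : Tendsto (fun n : ℕ => ∫ z in {z : ℝ | (n : ℝ) < |z|}, φ z) atTop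
      (𝓝 (∫ z in ⋂ n : ℕ, {z : ℝ | (n : ℝ) < |z|}, φ z)) := by
    refine tendsto_setIntegral_of_antitone (fun n => measurableSet_lt measurable_const
      continuous_abs.measurable) ?_ ⟨0, h.integrable.integrableOn⟩
    intro n k hnk x (hx : (k : ℝ) < |x|)
    exact lt_of_le_of_lt (by exact_mod_cast hnk) hx
  have hempty : ⋂ n : ℕ, {z : ℝ | (n : ℝ) < |z|} = ∅ := by
    ext z
    simp only [Set.mem_iInter, Set.mem_ofPred_eq, Set.mem_empty_iff_false, iff_false, not_forall,
      not_lt]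
    exact exists_nat_ge |z|
  rw [hempty, setIntegral_empty] at hlim
  obtain ⟨n, hn⟩ := (hlim.eventually (gt_mem_nhds he)).exists
  exact ⟨n, Nat.cast_nonneg n, hn⟩

/-- Large scales are small by the `O(1/t)` bound. At scales below `T`, most of the mass of `φ` lies
in `|z| ≤ Z` and samples `f` only at points `x - t z` far out, where `f` is small; the tail mass is
multiplied by at most `B`. -/
lemma exists_maxAvg_lt (h : IsAdmissible φ φ' φ'' a b C) (hf : Continuous f)
    (hB : ∀ x, |f x| ≤ B) (hfi : Integrable f volume) (hf0 : ∀ x, 0 ≤ f x)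
    (hlim : Tendsto f (cocompact ℝ) (𝓝 0)) {ε : ℝ} (hε : 0 < ε) :
    ∃ R, ∀ x, R ≤ |x| → maxAvg φ f x < ε := by
  have hB0 : 0 ≤ B := (abs_nonneg _).trans (hB 0)
  obtain ⟨T, hT, hTlt⟩ := h.exists_avg_lt hfi hf0 (half_pos hε)
  obtain ⟨Z, hZ0, hZ⟩ := h.exists_setIntegral_lt (e := ε / (4 * (B + 1))) (by positivity)
  obtain ⟨Y, hY⟩ : ∃ Y, ∀ y, Y ≤ |y| → f y ≤ ε / 4 := by
    have h1 : ∀ᶠ y in cocompact ℝ, f y < ε / 4 := hlim.eventually (gt_mem_nhds (by positivity))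
    rw [← Metric.cobounded_eq_cocompact, ← comap_norm_atTop, eventually_comap] at h1
    obtain ⟨Y, hY⟩ := eventually_atTop.1 h1
    exact ⟨Y, fun y hy => (hY _ hy y rfl).le⟩
  have hS : MeasurableSet {z : ℝ | Z < |z|} :=
    measurableSet_lt measurable_const continuous_abs.measurable
  refine ⟨Y + T * Z, fun x hx => ?_⟩
  refine lt_of_le_of_lt (maxAvg_le (c := ε / 2) fun t ht => ?_) (half_lt_self hε)
  rcases le_or_gt T t with htT | htT
  · exact (hTlt x t htT).le
  calc avg φ f x t
      ≤ ∫ z, (ε / 4 * φ z + B * Set.indicator {z | Z < |z|} φ z) := by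
        refine integral_mono (h.integrable_avg hf hB x t) ((h.integrable.const_mul _).add
          ((h.integrable.indicator hS).const_mul _)) fun z => ?_
        by_cases hz : z ∈ {z : ℝ | Z < |z|}
        · simp only [Set.indicator_of_mem hz]
          have h1 : f (x - t * z) * φ z ≤ B * φ z :=
            mul_le_mul_of_nonneg_right ((le_abs_self _).trans (hB _)) (h.nonneg z)
          have h2 : 0 ≤ ε / 4 * φ z := mul_nonneg (by positivity) (h.nonneg z)
          linarith
        · simp only [Set.indicator_of_notMem hz, mul_zero, add_zero]
          refine mul_le_mul_of_nonneg_right (hY _ ?_) (h.nonneg z)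
          have hz' : |z| ≤ Z := not_lt.1 hz
          have h3 : |t * z| ≤ T * Z := by
            rw [abs_mul, abs_of_pos ht]
            exact mul_le_mul htT.le hz' (abs_nonneg _) hT.le
          have h4 := abs_sub_abs_le_abs_sub x (t * z)
          linarith
    _ = ε / 4 + B * ∫ z in {z | Z < |z|}, φ z := by
        rw [integral_add (h.integrable.const_mul _) ((h.integrable.indicator hS).const_mul _),
          integral_const_mul, integral_const_mul, h.integral_eq_one, integral_indicator hS, mul_one]
    _ ≤ ε / 4 + B * (ε / (4 * (B + 1))) := by gcongr
    _ ≤ ε / 2 := by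
        have : B * (ε / (4 * (B + 1))) ≤ ε / 4 := by
          rw [mul_div_assoc', div_le_div_iff₀ (by positivity) (by positivity)]
          nlinarith
        linarith

/-- The maximal function of a nonnegative `W^{1,1}` function is detached from it. -/
theorem detached_maxAvg (h : IsAdmissible φ φ' φ'' a b C) (hp : HasPrim f (deriv f))
    (hfi : Integrable f volume) (hf0 : ∀ x, 0 ≤ f x) : Detached f (maxAvg φ f) := by
  have hf := hp.continuous
  have hB : ∀ x, |f x| ≤ ∫ t, |deriv f t| := hp.abs_le_integral hfi
  have hlim : Tendsto f (cocompact ℝ) (𝓝 0) := by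
    rw [cocompact_eq_atBot_atTop]
    exact (hp.tendsto_atBot_zero hfi).sup (hp.tendsto_atTop_zero hfi)
  have huc : UniformContinuous f := hf.uniformContinuous_of_tendsto_cocompact hlim
  have hcont : Continuous (maxAvg φ f) := by
    refine UniformContinuous.continuous (Metric.uniformContinuous_iff.2 fun ε hε => ?_)
    obtain ⟨δ, hδ, H⟩ := Metric.uniformContinuous_iff.1 huc (ε / 2) (half_pos hε)
    refine ⟨δ, hδ, fun x y hxy => lt_of_le_of_lt ?_ (half_lt_self hε)⟩
    rw [Real.dist_eq]
    refine h.abs_maxAvg_sub_le hf hB hf hB fun z => ?_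
    rw [← Real.dist_eq]
    exact (H (by simpa [Real.dist_eq] using hxy)).le
  refine ⟨hp, hcont, h.le_maxAvg hf hB, fun ε hε => ?_, ⟨∫ t, |deriv f t|, fun x => ?_⟩,
    h.convexOn_maxAvg hf hB hfi hf0 hcont⟩
  · obtain ⟨R, hR⟩ := h.exists_maxAvg_lt hf hB hfi hf0 hlim hε
    refine (isCompact_closedBall (0 : ℝ) R).of_isClosed_subset
      (isClosed_le continuous_const (hcont.sub hf)) fun x hx => ?_
    have hx' : ε ≤ maxAvg φ f x - f x := hx
    rw [Metric.mem_closedBall, dist_zero_right, Real.norm_eq_abs]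
    by_contra! hlt
    linarith [hR x hlt.le, hf0 x]
  · rw [abs_of_nonneg ((hf0 x).trans (h.le_maxAvg hf hB x))]
    exact maxAvg_le fun t _ => (le_abs_self _).trans (h.abs_avg_le hf hB x t)

end IsAdmissible
-- The three kernels are admissible
lemma fracProfile_eq (α x : ℝ) : fracProfile α x = (x ^ 2 + 1) ^ (-((2 - α) / 2)) := by
  rw [fracProfile, Real.rpow_neg (by positivity), one_div]

lemma hasDerivAt_sq_add_one_rpow (s z : ℝ) :
    HasDerivAt (fun z : ℝ => (z ^ 2 + 1) ^ s) (2 * s * z * (z ^ 2 + 1) ^ (s - 1)) z := by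
  have h1 : HasDerivAt (fun z : ℝ => z ^ 2 + 1) (2 * z) z := by
    simpa using (hasDerivAt_pow 2 z).add_const 1
  refine (h1.rpow_const (p := s) (Or.inl (by positivity))).congr_deriv ?_
  ring

lemma continuous_fracProfile (α : ℝ) : Continuous (fracProfile α) := by
  rw [funext (fracProfile_eq α)]
  exact continuous_iff_continuousAt.2 fun z => (hasDerivAt_sq_add_one_rpow _ z).continuousAt

lemma fracProfile_pos (α x : ℝ) : 0 < fracProfile α x := by
  rw [fracProfile_eq]; positivity

lemma integrable_fracProfile {α : ℝ} (hα : α < 1) : Integrable (fracProfile α) volume := by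
  have h1 := integrable_rpow_neg_one_add_norm_sq (E := ℝ) (μ := volume) (r := 2 - α)
    (by simp; linarith)
  refine h1.congr (ae_of_all _ fun x => ?_)
  simp only
  rw [fracProfile_eq, Real.norm_eq_abs, sq_abs, add_comm, neg_div]

lemma integral_fracProfile_pos {α : ℝ} (hα : α < 1) : 0 < ∫ y, fracProfile α y :=
  integral_pos_of_integrable_nonneg_nonzero (x := 0) (continuous_fracProfile α)
    (integrable_fracProfile hα) (fun x => (fracProfile_pos α x).le) (fracProfile_pos α 0).ne'

/-- With `p = (2 - α)/2`, the kernel and its first two derivatives are polynomials times `Q = (z² +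
1)^(-p-2)`. The equation becomes a polynomial identity, valid because `α = 2 - 2p`. The endpoint `α
= 0` is the Poisson kernel. -/
lemma isAdmissible_fracPoissonKernel {α : ℝ} (hα0 : 0 ≤ α) (hα : α < 1) :
    ∃ φ' φ'' C, IsAdmissible (fracPoissonKernel α) φ' φ'' 1 α C := by
  set p : ℝ := (2 - α) / 2 with hp
  have hp0 : 0 < p := by rw [hp]; linarith
  have hp1 : p ≤ 1 := by rw [hp]; linarith
  set c : ℝ := (∫ y, fracProfile α y)⁻¹ with hc
  have hc0 : 0 < c := inv_pos.2 (integral_fracProfile_pos hα)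
  have hker : fracPoissonKernel α = fun z => c * (z ^ 2 + 1) ^ (-p) :=
    funext fun z => by rw [fracPoissonKernel, fracProfile_eq]
  set Q : ℝ → ℝ := fun z => (z ^ 2 + 1) ^ (-p - 2) with hQ
  have hQ1 : ∀ z : ℝ, (z ^ 2 + 1) ^ (-p - 1) = (z ^ 2 + 1) * Q z := fun z => by
    simp only [hQ]
    rw [mul_comm, ← Real.rpow_add_one (by positivity)]
    ring_nf
  have hQ0 : ∀ z : ℝ, (z ^ 2 + 1) ^ (-p) = (z ^ 2 + 1) ^ 2 * Q z := fun z => by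
    rw [sq (z ^ 2 + 1), mul_assoc, ← hQ1, mul_comm, ← Real.rpow_add_one (by positivity)]
    ring_nf
  have hQpos : ∀ z, 0 < Q z := fun z => by simp only [hQ]; positivity
  have hQle : ∀ z, (z ^ 2 + 1) ^ 2 * Q z ≤ 1 := fun z => by
    rw [← hQ0]
    exact Real.rpow_le_one_of_one_le_of_nonpos (by nlinarith [sq_nonneg z]) (by linarith)
  set φ' : ℝ → ℝ := fun z => c * (-2 * p * z * ((z ^ 2 + 1) * Q z)) with hφ'
  set φ'' : ℝ → ℝ := fun z => c * (-2 * p * ((z ^ 2 + 1) * Q z) +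
    4 * p * (p + 1) * z ^ 2 * Q z) with hφ''
  -- As `p ≤ 1`, the coefficients of the second derivative add up to `2p + 4p(p+1) ≤ 10`.
  have hbase : ∀ z m : ℝ, |m| ≤ 10 * (z ^ 2 + 1) ^ 2 → |c * (m * Q z)| ≤ 10 * c := by
    intro z m hm
    rw [abs_mul, abs_mul, abs_of_pos hc0, abs_of_pos (hQpos z), mul_comm 10 c]
    refine mul_le_mul_of_nonneg_left ?_ hc0.le
    calc |m| * Q z ≤ 10 * (z ^ 2 + 1) ^ 2 * Q z :=
          mul_le_mul_of_nonneg_right hm (hQpos z).le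
      _ ≤ 10 := by linarith [hQle z]
  have hz1 : ∀ z : ℝ, |z| ≤ z ^ 2 + 1 := fun z => by
    rw [← sq_abs z]; nlinarith [sq_nonneg (|z| - 1), abs_nonneg z]
  have hcoef : ∀ z : ℝ, |-2 * p * (z ^ 2 + 1) + 4 * p * (p + 1) * z ^ 2| ≤
      10 * (z ^ 2 + 1) := fun z => by
    have h1 : p * (p + 1) ≤ 2 := by nlinarith
    have h2 : 0 ≤ p * (p + 1) := by positivity
    rw [abs_le]
    constructor <;> nlinarith [sq_nonneg z, mul_nonneg h2 (sq_nonneg z),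
      mul_nonneg (sub_nonneg.2 h1) (sq_nonneg z), mul_nonneg (sub_nonneg.2 hp1) (sq_nonneg z),
      mul_nonneg hp0.le (sq_nonneg z)]
  have hφ''eq : ∀ z, φ'' z = c * ((-2 * p * (z ^ 2 + 1) + 4 * p * (p + 1) * z ^ 2) * Q z) :=
    fun z => by simp only [hφ'']; ring
  have hq1 : ∀ z : ℝ, 1 ≤ z ^ 2 + 1 := fun z => by linarith [sq_nonneg z]
  refine ⟨φ', φ'', 10 * c, fun z => ?_, ?_, ?_, fun z => ?_, fun z => ?_, fun z => ?_, fun z => ?_,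
    fun z => ?_, fun z => ?_, fun z => ?_, zero_le_one, fun z => ?_⟩
  · rw [hker]; positivity
  · exact (integrable_fracProfile hα).const_mul _
  · simp only [fracPoissonKernel]
    rw [integral_const_mul]
    exact inv_mul_cancel₀ (integral_fracProfile_pos hα).ne'
  · rw [hker]
    refine ((hasDerivAt_sq_add_one_rpow (-p) z).const_mul c).congr_deriv ?_
    rw [hQ1]; simp only [hφ']; ring
  · have h1 : φ' = fun z => c * (-2 * p * (z * (z ^ 2 + 1) ^ (-p - 1))) := funext fun z => by
      rw [hQ1]; simp only [hφ']; ring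
    rw [h1]
    refine ((((hasDerivAt_id z).mul (hasDerivAt_sq_add_one_rpow (-p - 1) z)).const_mul
      (-2 * p)).const_mul c).congr_deriv ?_
    rw [hQ1, show -p - 1 - 1 = -p - 2 by ring]
    simp only [hφ'', hQ, id]; ring
  · simp only [hker]
    rw [hQ0]
    refine hbase z _ ?_
    rw [abs_of_nonneg (by positivity)]
    nlinarith [sq_nonneg (z ^ 2 + 1)]
  · rw [show φ' z = c * ((-2 * p * z * (z ^ 2 + 1)) * Q z) by simp only [hφ']; ring]
    refine hbase z _ ?_
    rw [abs_mul, abs_mul, abs_of_nonneg (zero_le_one.trans (hq1 z)), abs_mul, abs_neg, abs_two,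
      abs_of_pos hp0, sq (z ^ 2 + 1), ← mul_assoc]
    refine mul_le_mul_of_nonneg_right ?_ (zero_le_one.trans (hq1 z))
    nlinarith [hz1 z, abs_nonneg z, hq1 z, mul_nonneg hp0.le (abs_nonneg z),
      mul_nonneg (sub_nonneg.2 hp1) (abs_nonneg z)]
  · rw [show z * φ' z = c * ((-2 * p * z ^ 2 * (z ^ 2 + 1)) * Q z) by simp only [hφ']; ring]
    refine hbase z _ ?_
    rw [abs_mul, abs_mul, abs_of_nonneg (zero_le_one.trans (hq1 z)), abs_mul, abs_neg, abs_two,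
      abs_of_pos hp0, abs_of_nonneg (sq_nonneg z), sq (z ^ 2 + 1), ← mul_assoc]
    refine mul_le_mul_of_nonneg_right ?_ (zero_le_one.trans (hq1 z))
    nlinarith [sq_nonneg z, mul_nonneg (sub_nonneg.2 hp1) (sq_nonneg z)]
  · rw [hφ''eq]
    refine hbase z _ ((hcoef z).trans ?_)
    nlinarith [hq1 z]
  · rw [hφ''eq, show ∀ A : ℝ, z ^ 2 * (c * (A * Q z)) = c * ((z ^ 2 * A) * Q z) from
      fun A => by ring]
    refine hbase z _ ?_
    rw [abs_mul, abs_of_nonneg (sq_nonneg z)]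
    calc z ^ 2 * _ ≤ (z ^ 2 + 1) * (10 * (z ^ 2 + 1)) :=
          mul_le_mul (by linarith) (hcoef z) (abs_nonneg _) (by positivity)
      _ = 10 * (z ^ 2 + 1) ^ 2 := by ring
  · simp only [hker]
    rw [hQ0]
    simp only [hφ', hφ'']
    have hαp : α = 2 - 2 * p := by rw [hp]; ring
    rw [hαp]
    ring

lemma realPoissonKernel_eq : realPoissonKernel = fracPoissonKernel 0 := by
  have h1 : ∀ x, fracProfile 0 x = (1 + x ^ 2)⁻¹ := fun x => by
    rw [fracProfile_eq, add_comm]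
    norm_num
    rw [Real.rpow_neg_one]
  funext x
  rw [fracPoissonKernel, funext h1, integral_univ_inv_one_add_sq, realPoissonKernel, add_comm,
    one_div, one_div]

/-- Here `t` is the width, that is, the heat time is `t²`, so the heat equation reads `U_xx = U_t /
(2t)`. -/
lemma isAdmissible_heatKernel : ∃ φ' φ'' C, IsAdmissible heatKernel φ' φ'' 0 (-(1 / 2)) C := by
  set c : ℝ := 1 / Real.sqrt (4 * Real.pi) with hc
  have hsq : 0 < Real.sqrt (4 * Real.pi) := Real.sqrt_pos.2 (by positivity)
  have hc0 : 0 < c := by rw [hc]; positivity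
  set E : ℝ → ℝ := fun z => Real.exp (-z ^ 2 / 4) with hE
  have hEpos : ∀ z, 0 < E z := fun z => Real.exp_pos _
  have hEd : ∀ z, HasDerivAt E (-(z / 2) * E z) z := fun z => by
    have h1 : HasDerivAt (fun z : ℝ => -z ^ 2 / 4) (-(z / 2)) z := by
      refine ((hasDerivAt_pow 2 z).neg.div_const 4).congr_deriv ?_
      norm_num
      ring
    refine h1.exp.congr_deriv ?_
    simp only [hE]; ring
  -- From `exp(z²/4) ≥ (1 + z²/8)²`; the constant 64 would already suffice.
  have hE2 : ∀ z, (1 + z ^ 2 + z ^ 4) * E z ≤ 69 := fun z => by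
    have h1 : E z * Real.exp (z ^ 2 / 4) = 1 := by
      simp only [hE]
      rw [← Real.exp_add, ← Real.exp_zero]
      ring_nf
    have h2 : z ^ 2 / 8 + 1 ≤ Real.exp (z ^ 2 / 8) := Real.add_one_le_exp _
    have h3 : (z ^ 2 / 8 + 1) ^ 2 ≤ Real.exp (z ^ 2 / 4) := by
      have h4 : Real.exp (z ^ 2 / 4) = Real.exp (z ^ 2 / 8) ^ 2 := by
        rw [sq (Real.exp _), ← Real.exp_add]; ring_nf
      rw [h4]
      exact pow_le_pow_left₀ (by positivity) h2 2
    have h5 : 1 + z ^ 2 + z ^ 4 ≤ 69 * Real.exp (z ^ 2 / 4) := by nlinarith [sq_nonneg z]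
    calc (1 + z ^ 2 + z ^ 4) * E z ≤ 69 * Real.exp (z ^ 2 / 4) * E z :=
          mul_le_mul_of_nonneg_right h5 (hEpos z).le
      _ = 69 * (E z * Real.exp (z ^ 2 / 4)) := by ring
      _ = 69 := by rw [h1, mul_one]
  have hbase : ∀ z m : ℝ, |m| ≤ 1 + z ^ 2 + z ^ 4 → |c * (m * E z)| ≤ 69 * c := by
    intro z m hm
    rw [abs_mul, abs_mul, abs_of_pos hc0, abs_of_pos (hEpos z), mul_comm 69 c]
    exact mul_le_mul_of_nonneg_left
      ((mul_le_mul_of_nonneg_right hm (hEpos z).le).trans (hE2 z)) hc0.le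
  refine ⟨fun z => c * (-(z / 2) * E z), fun z => c * ((z ^ 2 / 4 - 1 / 2) * E z), 69 * c,
    fun z => ?_, ?_, ?_, fun z => ?_, fun z => ?_, fun z => ?_, fun z => ?_,
    fun z => ?_, fun z => ?_, fun z => ?_, le_rfl, fun z => ?_⟩
  · exact mul_nonneg hc0.le (hEpos z).le
  · have h1 := (integrable_exp_neg_mul_sq (b := 1 / 4) (by norm_num)).const_mul c
    refine h1.congr (ae_of_all _ fun z => ?_)
    simp only [heatKernel]
    rw [show -(1 / 4) * z ^ 2 = -z ^ 2 / 4 by ring]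
  · have h1 := integral_gaussian (1 / 4)
    rw [show Real.pi / (1 / 4) = 4 * Real.pi by ring] at h1
    have h2 : ∀ z, heatKernel z = c * Real.exp (-(1 / 4) * z ^ 2) := fun z => by
      rw [heatKernel, show -(1 / 4) * z ^ 2 = -z ^ 2 / 4 by ring]
    rw [funext h2, integral_const_mul, h1, hc, one_div, inv_mul_cancel₀ hsq.ne']
  · exact (hEd z).const_mul c
  · have h1 : HasDerivAt (fun z : ℝ => -(z / 2)) (-(1 / 2)) z :=
      ((hasDerivAt_id z).div_const 2).neg
    refine ((h1.mul (hEd z)).const_mul c).congr_deriv ?_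
    ring
  · have := hbase z 1 (by rw [abs_one]; nlinarith [sq_nonneg z, sq_nonneg (z ^ 2)])
    rwa [one_mul] at this
  · exact hbase z _ (abs_le.2 ⟨by nlinarith [sq_nonneg (z - 1), sq_nonneg (z + 1), sq_nonneg (z ^ 2)],
      by nlinarith [sq_nonneg (z - 1), sq_nonneg (z + 1), sq_nonneg (z ^ 2)]⟩)
  · rw [show z * (c * (-(z / 2) * E z)) = c * ((-(z ^ 2 / 2)) * E z) by ring]
    exact hbase z _ (abs_le.2 ⟨by nlinarith [sq_nonneg z, sq_nonneg (z ^ 2)],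
      by nlinarith [sq_nonneg z, sq_nonneg (z ^ 2)]⟩)
  · exact hbase z _ (abs_le.2 ⟨by nlinarith [sq_nonneg z, sq_nonneg (z ^ 2)],
      by nlinarith [sq_nonneg z, sq_nonneg (z ^ 2)]⟩)
  · rw [show z ^ 2 * (c * ((z ^ 2 / 4 - 1 / 2) * E z)) = c * ((z ^ 4 / 4 - z ^ 2 / 2) * E z) by
      ring]
    exact hbase z _ (abs_le.2 ⟨by nlinarith [sq_nonneg z, sq_nonneg (z ^ 2)],
      by nlinarith [sq_nonneg z, sq_nonneg (z ^ 2)]⟩)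
  · simp only [heatKernel]
    change c * ((z ^ 2 / 4 - 1 / 2) * E z) = -(1 / 2) * (c * E z + z * (c * (-(z / 2) * E z))) -
      0 * _
    ring

lemma IsKernel.exists_isAdmissible {φ : ℝ → ℝ} (h : IsKernel φ) :
    ∃ φ' φ'' a b C, IsAdmissible φ φ' φ'' a b C := by
  rcases h with rfl | rfl | ⟨α, hα0, hα1, rfl⟩
  · obtain ⟨φ', φ'', C, h⟩ := isAdmissible_fracPoissonKernel le_rfl (α := 0) one_pos
    exact ⟨φ', φ'', 1, 0, C, realPoissonKernel_eq ▸ h⟩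
  · obtain ⟨φ', φ'', C, h⟩ := isAdmissible_heatKernel
    exact ⟨φ', φ'', _, _, C, h⟩
  · obtain ⟨φ', φ'', C, h⟩ := isAdmissible_fracPoissonKernel hα0.le hα1
    exact ⟨φ', φ'', _, _, C, h⟩

/-! ### Weak derivatives and absolutely continuous representatives -/

lemma exists_forall_eq_zero_of_hasCompactSupport {ψ : ℝ → ℝ} (hψ : HasCompactSupport ψ) :
    ∃ R, 0 < R ∧ ∀ x, R ≤ |x| → ψ x = 0 := by
  obtain ⟨R, hR, hsub⟩ := hψ.isBounded.subset_ball_lt 0 0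
  refine ⟨R, hR, fun x hx => image_eq_zero_of_notMem_tsupport fun hmem => ?_⟩
  have := hsub hmem
  rw [Metric.mem_ball, dist_zero_right, Real.norm_eq_abs] at this
  linarith

lemma integral_eq_intervalIntegral_of_eq_zero {h : ℝ → ℝ} {R : ℝ}
    (hh : ∀ x, R ≤ |x| → h x = 0) : ∫ x, h x = ∫ x in -R..R, h x := by
  refine (intervalIntegral.integral_eq_integral_of_support_subset fun x hx => ?_).symm
  have h1 : |x| < R := not_le.1 fun hle => hx (hh x hle)
  exact ⟨(abs_lt.1 h1).1, (abs_lt.1 h1).2.le⟩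

lemma HasPrim.isWeakDeriv {f g : ℝ → ℝ} (h : HasPrim f g) : IsWeakDeriv f g := by
  refine ⟨h.continuous.locallyIntegrable, h.integrable.locallyIntegrable, fun ψ hψ hc => ?_⟩
  obtain ⟨R, hR, hψR⟩ := exists_forall_eq_zero_of_hasCompactSupport hc
  obtain ⟨R', hR', hψR'⟩ := exists_forall_eq_zero_of_hasCompactSupport hc.deriv
  have h1 : ∫ x, f x * deriv ψ x = ∫ x in -max R R'..max R R', f x * deriv ψ x :=
    integral_eq_intervalIntegral_of_eq_zero fun x hx => by
      rw [hψR' x ((le_max_right _ _).trans hx), mul_zero]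
  have h2 : ∫ x, g x * ψ x = ∫ x in -max R R'..max R R', g x * ψ x :=
    integral_eq_intervalIntegral_of_eq_zero fun x hx => by
      rw [hψR x ((le_max_left _ _).trans hx), mul_zero]
  have hac : AbsolutelyContinuousOnInterval ψ (-max R R') (max R R') :=
    (hψ.of_le (by exact_mod_cast le_top)).contDiffOn.absolutelyContinuousOnInterval
  rw [h1, h2, (h.absolutelyContinuousOnInterval _ _).integral_mul_deriv_eq_deriv_mul hac,
    hψR (max R R') ((le_max_left _ _).trans (le_abs_self _)),
    hψR (-max R R') ((le_max_left _ _).trans (by rw [abs_neg]; exact le_abs_self _)),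
    mul_zero, mul_zero, sub_zero, zero_sub]
  congr 1
  exact intervalIntegral.integral_congr_ae (h.deriv_ae_eq.mono fun x hx _ => by rw [hx])

lemma IsWeakDeriv.ae_eq {f g₁ g₂ : ℝ → ℝ} (h₁ : IsWeakDeriv f g₁) (h₂ : IsWeakDeriv f g₂) :
    g₁ =ᵐ[volume] g₂ := by
  refine ae_eq_of_integral_contDiff_smul_eq h₁.2.1 h₂.2.1 fun ψ hψ hc => ?_
  have h3 := (h₁.2.2 ψ hψ hc).symm.trans (h₂.2.2 ψ hψ hc)
  simpa only [smul_eq_mul, mul_comm] using neg_injective h3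

lemma IsWeakDeriv.congr_ae {f₁ f₂ g : ℝ → ℝ} (h : IsWeakDeriv f₁ g) (hf : f₁ =ᵐ[volume] f₂) :
    IsWeakDeriv f₂ g := by
  refine ⟨h.1.congr hf, h.2.1, fun ψ hψ hc => ?_⟩
  rw [← h.2.2 ψ hψ hc]
  exact integral_congr_ae (hf.mono fun x hx => by simp only [hx])

lemma WeaklyDifferentiable.isWeakDeriv {f : ℝ → ℝ} (h : WeaklyDifferentiable f) :
    IsWeakDeriv f (weakDeriv f) := by
  rw [weakDeriv, dif_pos h]
  exact h.choose_spec

lemma IsWeakDeriv.weakDeriv_ae_eq {f g : ℝ → ℝ} (h : IsWeakDeriv f g) :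
    weakDeriv f =ᵐ[volume] g :=
  (WeaklyDifferentiable.isWeakDeriv ⟨g, h⟩).ae_eq h

/-- A smooth compactly supported function of integral zero is the derivative of another one. -/
lemma exists_deriv_eq_of_integral_eq_zero {θ : ℝ → ℝ} (hθ : ContDiff ℝ ∞ θ)
    (hc : HasCompactSupport θ) (h0 : ∫ x, θ x = 0) :
    ∃ Θ : ℝ → ℝ, ContDiff ℝ ∞ Θ ∧ HasCompactSupport Θ ∧ deriv Θ = θ := by
  obtain ⟨R, hR, hθR⟩ := exists_forall_eq_zero_of_hasCompactSupport hc
  have hint : ∀ a b, IntervalIntegrable θ volume a b := fun a b =>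
    hθ.continuous.intervalIntegrable a b
  set Θ : ℝ → ℝ := fun x => ∫ t in -R..x, θ t with hΘ
  have hd : ∀ x, HasDerivAt Θ (θ x) x := fun x =>
    intervalIntegral.integral_hasDerivAt_right (hint _ _)
      (hθ.continuous.stronglyMeasurableAtFilter _ _) hθ.continuous.continuousAt
  have hderiv : deriv Θ = θ := funext fun x => (hd x).deriv
  refine ⟨Θ, ?_, ?_, hderiv⟩
  · rw [contDiff_infty_iff_deriv, hderiv]
    exact ⟨fun x => (hd x).differentiableAt, hθ⟩
  · refine HasCompactSupport.intro (isCompact_closedBall (0 : ℝ) R) fun x hx => ?_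
    rw [Metric.mem_closedBall, dist_zero_right, Real.norm_eq_abs, not_le] at hx
    rcases le_or_gt x 0 with hx0 | hx0
    · rw [abs_of_nonpos hx0] at hx
      simp only [hΘ]
      rw [intervalIntegral.integral_symm, intervalIntegral.integral_zero_ae, neg_zero]
      refine ae_of_all _ fun t ht => hθR t ?_
      rw [Set.uIoc_of_le (by linarith)] at ht
      rw [abs_of_nonpos (by linarith [ht.2])]
      linarith [ht.2]
    · rw [abs_of_pos hx0] at hx
      have h1 : ∫ t in -R..R, θ t = 0 := by
        rw [← integral_eq_intervalIntegral_of_eq_zero hθR, h0]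
      have h2 : ∫ t in R..x, θ t = 0 := by
        rw [intervalIntegral.integral_zero_ae]
        refine ae_of_all _ fun t ht => hθR t ?_
        rw [Set.uIoc_of_le hx.le] at ht
        exact ht.1.le.trans (le_abs_self t)
      simp only [hΘ]
      rw [← intervalIntegral.integral_add_adjacent_intervals (hint (-R) R) (hint R x), h1, h2,
        add_zero]

/-- The lemma of du Bois-Reymond: a function with vanishing weak derivative is constant. -/
lemma ae_eq_const_of_integral_mul_deriv_eq_zero {f : ℝ → ℝ} (hf : LocallyIntegrable f volume)
    (h : ∀ ψ : ℝ → ℝ, ContDiff ℝ ∞ ψ → HasCompactSupport ψ → ∫ x, f x * deriv ψ x = 0) :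
    ∃ c : ℝ, f =ᵐ[volume] fun _ => c := by
  let b : ContDiffBump (0 : ℝ) := ⟨1, 2, one_pos, one_lt_two⟩
  set χ : ℝ → ℝ := b.normed volume with hχ
  have hχd : ContDiff ℝ ∞ χ := b.contDiff_normed
  have hχc : HasCompactSupport χ := b.hasCompactSupport_normed
  have hχ1 : ∫ x, χ x = 1 := b.integral_normed
  have hmul : ∀ ψ : ℝ → ℝ, ContDiff ℝ ∞ ψ → HasCompactSupport ψ →
      Integrable (fun x => f x * ψ x) volume := fun ψ hψ hc => by
    have := hf.integrable_smul_left_of_hasCompactSupport hψ.continuous hc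
    simpa only [smul_eq_mul, mul_comm] using this
  refine ⟨∫ x, f x * χ x, ae_eq_of_integral_contDiff_smul_eq hf (locallyIntegrable_const _)
    fun ψ hψ hc => ?_⟩
  have hψi : Integrable ψ volume := hψ.continuous.integrable_of_hasCompactSupport hc
  have hχi : Integrable χ volume := hχd.continuous.integrable_of_hasCompactSupport hχc
  set I : ℝ := ∫ x, ψ x with hI
  have hIχ : ContDiff ℝ ∞ fun x => I * χ x := contDiff_const.mul hχd
  have hIχc : HasCompactSupport fun x => I * χ x := hχc.mul_left
  -- Subtracting `(∫ ψ) χ`, with `∫ χ = 1`, makes the test function a derivative, so `∫ f ψ = (∫ ψ)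
  -- (∫ f χ)`.
  obtain ⟨Θ, hΘ1, hΘ2, hΘ3⟩ := exists_deriv_eq_of_integral_eq_zero
    (θ := fun x => ψ x - I * χ x) (hψ.sub hIχ) (hc.sub hIχc) (by
      rw [integral_sub hψi (hχi.const_mul I), integral_const_mul, hχ1, mul_one, sub_self])
  have h1 := h Θ hΘ1 hΘ2
  rw [hΘ3] at h1
  simp only [mul_sub] at h1
  rw [integral_sub (hmul ψ hψ hc) (hmul _ hIχ hIχc)] at h1
  have h2 : ∫ x, f x * (I * χ x) = I * ∫ x, f x * χ x := by
    rw [← integral_const_mul]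
    exact integral_congr_ae (ae_of_all _ fun x => by ring)
  simp only [smul_eq_mul]
  rw [integral_mul_const, ← hI, ← h2]
  simp only [mul_comm (ψ _)]
  linarith

/-- The function and the primitive of its weak derivative have the same weak derivative, so they
differ by a constant almost everywhere. -/
lemma MemW11.exists_hasPrim {v : ℝ → ℝ} (hv : MemW11 v) :
    ∃ V, v =ᵐ[volume] V ∧ HasPrim V (weakDeriv v) := by
  have hw := hv.2.1.isWeakDeriv
  set g := weakDeriv v with hg
  have hgi : Integrable g volume := hv.2.2
  have hP : HasPrim (fun x => ∫ t in (0 : ℝ)..x, g t) g := ⟨hgi, fun x y =>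
    intervalIntegral.integral_interval_sub_left hgi.intervalIntegrable hgi.intervalIntegrable⟩
  have hPw := hP.isWeakDeriv
  obtain ⟨c, hc⟩ := ae_eq_const_of_integral_mul_deriv_eq_zero (hw.1.sub hPw.1)
    fun ψ hψ hψc => by
      have hd : Continuous (deriv ψ) := hψ.continuous_deriv (by exact_mod_cast le_top)
      have hm : ∀ f : ℝ → ℝ, LocallyIntegrable f volume →
          Integrable (fun x => f x * deriv ψ x) volume := fun f hf => by
        have := hf.integrable_smul_left_of_hasCompactSupport hd hψc.deriv
        simpa only [smul_eq_mul, mul_comm] using this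
      simp only [Pi.sub_apply, sub_mul]
      rw [integral_sub (hm _ hw.1) (hm _ hPw.1), hw.2.2 ψ hψ hψc, hPw.2.2 ψ hψ hψc, sub_self]
  refine ⟨fun x => c + ∫ t in (0 : ℝ)..x, g t, ?_, hgi, fun x y => ?_⟩
  · filter_upwards [hc] with x hx
    rw [← hx]
    simp
  · rw [add_sub_add_left_eq_sub]
    exact hP.sub_eq x y

/-! ### Absolute values and the choice of representative -/

lemma HasPrim.absolutelyContinuousOnInterval_abs {V g : ℝ → ℝ} (h : HasPrim V g) (a b : ℝ) :
    AbsolutelyContinuousOnInterval (fun x => |V x|) a b := by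
  rw [absolutelyContinuousOnInterval_iff]
  intro ε hε
  obtain ⟨δ, hδ, H⟩ := (absolutelyContinuousOnInterval_iff V a b).1
    (h.absolutelyContinuousOnInterval a b) ε hε
  refine ⟨δ, hδ, fun E hE hlt => lt_of_le_of_lt (Finset.sum_le_sum fun i _ => ?_) (H E hE hlt)⟩
  exact abs_abs_sub_abs_le_abs_sub _ _

/-- A zero at which the derivative is nonzero is isolated, so such zeros form a discrete, hence
countable, hence null set. -/
lemma HasPrim.ae_eq_zero_of_eq_zero {V g : ℝ → ℝ} (h : HasPrim V g) :
    ∀ᵐ x, V x = 0 → g x = 0 := by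
  set S : Set ℝ := {x | V x = 0 ∧ HasDerivAt V (g x) x ∧ g x ≠ 0} with hS
  have hdisc : DiscreteTopology S := by
    rw [discreteTopology_subtype_iff]
    rintro x ⟨hx, hd, hne⟩
    rw [← Filter.empty_mem_iff_bot, mem_inf_principal]
    filter_upwards [hd.eventually_ne (c := 0) hne] with y hy hyS
    exact hy hyS.1
  have hcount : S.Countable := by
    rw [← Set.countable_coe_iff]
    exact TopologicalSpace.separableSpace_iff_countable.1 inferInstance
  filter_upwards [h.ae_hasDerivAt, hcount.ae_notMem volume] with x hd hx hV
  by_contra hne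
  exact hx ⟨hV, hd, hne⟩

lemma HasPrim.ae_abs_deriv_abs {V g : ℝ → ℝ} (h : HasPrim V g) :
    ∀ᵐ x, |deriv (fun y => |V y|) x| = |g x| := by
  filter_upwards [h.ae_hasDerivAt, h.ae_eq_zero_of_eq_zero] with x hd h0
  rcases lt_trichotomy (V x) 0 with hx | hx | hx
  · have h1 : (fun y => |V y|) =ᶠ[𝓝 x] fun y => -V y := by
      filter_upwards [hd.continuousAt.eventually (gt_mem_nhds hx)] with y hy using abs_of_neg hy
    rw [h1.deriv_eq, hd.fun_neg.deriv, abs_neg]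
  · have h1 : IsLocalMin (fun y => |V y|) x := Eventually.of_forall fun y => by
      simp only [hx, abs_zero]
      exact abs_nonneg _
    rw [h1.deriv_eq_zero, h0 hx]
  · have h1 : (fun y => |V y|) =ᶠ[𝓝 x] V := by
      filter_upwards [hd.continuousAt.eventually (lt_mem_nhds hx)] with y hy using abs_of_pos hy
    rw [h1.deriv_eq, hd.deriv]

lemma HasPrim.abs {V g : ℝ → ℝ} (h : HasPrim V g) :
    HasPrim (fun x => |V x|) (deriv fun x => |V x|) := by
  refine .of_absolutelyContinuousOnInterval h.absolutelyContinuousOnInterval_abs ?_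
  refine h.integrable.mono (measurable_deriv _).aestronglyMeasurable ?_
  filter_upwards [h.ae_abs_deriv_abs] with x hx using hx.le

/-- Convolutions see only the almost-everywhere class, so the equality holds at every point although
`u` and `U` may differ on a null set. -/
lemma maximalFunction_eq_maxAvg (φ : ℝ → ℝ) {u U : ℝ → ℝ} (hu : u =ᵐ[volume] U) :
    maximalFunction φ u = maxAvg φ fun x => |U x| := by
  funext x
  rw [maximalFunction, maxAvg]
  congr 1
  funext t
  rw [← scaledConv_one_eq_avg φ _ x t.2, extension, convolution, scaledConv]
  refine integral_congr_ae ?_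
  filter_upwards [hu] with y hy
  simp [hy, dilate]

end ConvMax

/-! ### The main theorem -/

theorem mainTheorem3 (φ : ℝ → ℝ) (hφ : ConvMax.IsKernel φ)
    (u : ℕ → ℝ → ℝ) (v : ℝ → ℝ)
    (hu : ∀ j, ConvMax.MemW11 (u j)) (hv : ConvMax.MemW11 v)
    (huv : Tendsto (fun j => ConvMax.normW11 (fun x => u j x - v x)) atTop (𝓝 0)) :
    (∀ j, ConvMax.WeaklyDifferentiable (ConvMax.maximalFunction φ (u j)) ∧
      Integrable (ConvMax.weakDeriv (ConvMax.maximalFunction φ (u j))) volume) ∧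
    (ConvMax.WeaklyDifferentiable (ConvMax.maximalFunction φ v) ∧
      Integrable (ConvMax.weakDeriv (ConvMax.maximalFunction φ v)) volume) ∧
    Tendsto (fun j => ConvMax.normL1 (ConvMax.weakDeriv (ConvMax.maximalFunction φ (u j)))) atTop
      (𝓝 (ConvMax.normL1 (ConvMax.weakDeriv (ConvMax.maximalFunction φ v)))) := by
  obtain ⟨φ', φ'', a, b, C, hadm⟩ := hφ.exists_isAdmissible
  choose U hU hUp using fun j => (hu j).exists_hasPrim
  obtain ⟨V, hV, hVp⟩ := hv.exists_hasPrim
  have hdet : ∀ {w W : ℝ → ℝ}, ConvMax.MemW11 w → w =ᵐ[volume] W →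
      ConvMax.HasPrim W (ConvMax.weakDeriv w) →
      ConvMax.Detached (fun x => |W x|) (ConvMax.maxAvg φ fun x => |W x|) := fun hw hwW hW =>
    hadm.detached_maxAvg hW.abs (hw.1.congr hwW).abs fun x => abs_nonneg _
  have hD := fun j => hdet (hu j) (hU j) (hUp j)
  have hD₀ := hdet hv hV hVp
  have hwd : ∀ {w W : ℝ → ℝ}, w =ᵐ[volume] W →
      ConvMax.Detached (fun x => |W x|) (ConvMax.maxAvg φ fun x => |W x|) →
      ConvMax.IsWeakDeriv (ConvMax.maximalFunction φ w)
        (deriv (ConvMax.maxAvg φ fun x => |W x|)) := fun hwW hW => by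
    rw [ConvMax.maximalFunction_eq_maxAvg φ hwW]
    exact hW.hasPrim_right.isWeakDeriv
  have hfirst : ∀ {w W : ℝ → ℝ}, w =ᵐ[volume] W →
      ConvMax.Detached (fun x => |W x|) (ConvMax.maxAvg φ fun x => |W x|) →
      ConvMax.WeaklyDifferentiable (ConvMax.maximalFunction φ w) ∧
        Integrable (ConvMax.weakDeriv (ConvMax.maximalFunction φ w)) volume := fun hwW hW =>
    ⟨⟨_, hwd hwW hW⟩, hW.integrable_deriv.congr (hwd hwW hW).weakDeriv_ae_eq.symm⟩
  have hnorm : ∀ {w W : ℝ → ℝ}, w =ᵐ[volume] W →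
      ConvMax.Detached (fun x => |W x|) (ConvMax.maxAvg φ fun x => |W x|) →
      ConvMax.normL1 (ConvMax.weakDeriv (ConvMax.maximalFunction φ w)) =
        ∫ x, |deriv (ConvMax.maxAvg φ fun x => |W x|) x| := fun hwW hW =>
    integral_congr_ae ((hwd hwW hW).weakDeriv_ae_eq.mono fun x hx => by simp only [hx])
  refine ⟨fun j => hfirst (hU j) (hD j), hfirst hV hD₀, ?_⟩
  simp only [fun j => hnorm (hU j) (hD j), hnorm hV hD₀]
  -- This single sequence, the `L¹` distance of the weak derivatives, bounds the uniform distances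
  -- of the moduli and of the maximal functions as well.
  set c : ℕ → ℝ := fun j => ∫ x, |ConvMax.weakDeriv (u j) x - ConvMax.weakDeriv v x| with hc
  have hsub := fun j => (hUp j).sub hVp
  have hc0 : Tendsto c atTop (𝓝 0) := by
    refine squeeze_zero (fun j => integral_nonneg fun x => abs_nonneg _) (fun j => ?_) huv
    have h1 : ConvMax.IsWeakDeriv (fun x => u j x - v x)
        (fun x => ConvMax.weakDeriv (u j) x - ConvMax.weakDeriv v x) := by
      refine (hsub j).isWeakDeriv.congr_ae ?_
      filter_upwards [hU j, hV] with x hx hx'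
      rw [hx, hx']
    have h2 : c j = ConvMax.normL1 (ConvMax.weakDeriv fun x => u j x - v x) :=
      integral_congr_ae (h1.weakDeriv_ae_eq.mono fun x hx => by simp only [hx])
    rw [h2, ConvMax.normW11]
    exact le_add_of_nonneg_left (integral_nonneg fun x => abs_nonneg _)
  have hUV : ∀ j x, |U j x - V x| ≤ c j := fun j x =>
    (hsub j).abs_le_integral (((hu j).1.congr (hU j)).sub (hv.1.congr hV)) x
  have hf : ∀ j x, |(|U j x| - |V x|)| ≤ c j := fun j x =>
    (abs_abs_sub_abs_le_abs_sub _ _).trans (hUV j x)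
  have hF : ∀ j x, |ConvMax.maxAvg φ (fun x => |U j x|) x - ConvMax.maxAvg φ (fun x => |V x|) x| ≤
      c j := fun j x => by
    have hb : ∀ {w W : ℝ → ℝ}, ConvMax.MemW11 w → w =ᵐ[volume] W →
        ConvMax.HasPrim W (ConvMax.weakDeriv w) → ∀ x, |(|W x|)| ≤ ∫ t, |ConvMax.weakDeriv w t| :=
      fun hw hwW hW x => by
        rw [abs_abs]
        exact hW.abs_le_integral (hw.1.congr hwW) x
    exact hadm.abs_maxAvg_sub_le (hUp j).abs.continuous
      (fun y => (hb (hu j) (hU j) (hUp j) y).trans (le_max_left _ _)) hVp.abs.continuous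
      (fun y => (hb hv hV hVp y).trans (le_max_right _ _)) fun z => hf j (x - z)
  -- Comparing with `|u_j'|` in place of the derivative of `|u_j|` avoids proving that the modulus
  -- is continuous on `W^{1,1}`.
  exact hD₀.tendsto_integral_abs_deriv hD hc0 hf hF
    (p := fun j x => |ConvMax.weakDeriv (u j) x|) (p₀ := fun x => |ConvMax.weakDeriv v x|)
    (fun j => (hUp j).integrable.abs) hVp.integrable.abs
    (fun j => (hUp j).ae_abs_deriv_abs.mono fun x hx => hx.le)
    (hVp.ae_abs_deriv_abs.mono fun x hx => hx.symm)
    (squeeze_zero (fun j => integral_nonneg fun x => abs_nonneg _) (fun j =>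
      integral_mono ((hUp j).integrable.abs.sub hVp.integrable.abs).abs (hsub j).integrable.abs
        fun x => abs_abs_sub_abs_le_abs_sub _ _) hc0)
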